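/- **Setting.** Let $R\ge 2$ be an integer. For a finite set $B\subset\mathbb Z$ with $0\in B$ and $N=\#B$, put $\tau_b(x)=R^{-1}(x+b)$ for $b\in B$; let $X_B=\{\sum_{k\ge1}R^{-k}b_k: b_k\in B\}$ be the attractor of this iterated function system and $\mu_B$ its invariant measure, i.e. the unique Borel probability measure on $\mathbb R$ with $\mu_B(E)=\frac1N\sum_{b\in B}\mu_B(\tau_b^{-1}E)$ for all Borel sets $E$. For finite $L\subset\mathbb Z$ with $0\in L$, $(B,L)$ is a *Hadamard pair with scaling factor $R$* if $\#L=\#B=N$ and the matrix $\frac1{\sqrt N}(e^{2\pi i R^{-1}bl})_{b\in B,\,l\in L}$ is unitary. Real points $x_0,\dots,x_{r-1}$ ($r\ge1$, not necessarily distinct) form a *cycle* for $L$ with *digits* $l_0,\dots,l_{r-1}\in L$ if $(x_k+l_k)/R=x_{k+1}$ for all $k$, with indices modulo $r$; the cycle is *extreme* for $(B,L)$ if $\bigl|\frac1N\sum_{b\in B}e^{2\pi i b x_k}\bigr|=1$ for all $k$. Sets $A,A'\subset\mathbb Z$ have *disjoint differences* if $(A-A)\cap(A'-A')=\{0\}$;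 then $A+A'$ is written $A\oplus A'$. Hadamard pairs $(B,L)$ and $(B',L')$ with scaling factor $R$ are *complementary* if (a) $B,B'$ have disjoint differences, $L,L'$ have disjoint differences, and $B\oplus B'$ and $L\oplus L'$ are complete sets of representatives modulo $R$; (b) all points of extreme cycles for $(B,L)$ and for $(B',L')$ are integers; (c) the greatest common divisor of the elements of $B\oplus B'$ is $1$. In that case let $p:L\oplus L'\to L$ and $p':L\oplus L'\to L'$ be given by $p(l+l')=l$, $p'(l+l')=l'$. Let $\Lambda(L)$ be the set of integers $x$ for which there are integers $x_0=x,x_1,x_2,\dots$ and $l_0,l_1,\dots\in L$ with $x_k=Rx_{k+1}+l_k$ for all $k\ge0$. A set $\Lambda\subset\mathbb R$ is a *spectrum* of a finite Borel measure $\mu$ on $\mathbb R$ if $\{e^{2\pi i\lambda x}:\lambda\in\Lambda\}$ is an orthogonal basis of $L^2(\mu)$. **Theorem.** Let $(B,L)$ and $(B',L')$ be complementary Hadamard pairs with scaling factor $R$. 1. The measure $\mu_{B\oplus B'}$ is Lebesgue measure restricted to the attractor $X_{B\oplus B'}$, and it has spectrum $\mathbb Z$. Moreover $X_{B\oplus B'}$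 is translation congruent to $[0,1]$: there are measurable sets $A_n$, $n\in\mathbb Z$, such that, up to sets of Lebesgue measure zero, $\{A_n\}_{n\in\mathbb Z}$ is a partition of $[0,1]$ and $\{A_n+n\}_{n\in\mathbb Z}$ is a partition of $X_{B\oplus B'}$. 2. $\mu_{B\oplus B'}=\mu_B*\mu_{B'}$. 3. $\Lambda(L)$ is a spectrum of $\mu_B$ and $\Lambda(L')$ is a spectrum of $\mu_{B'}$. 4. $\Lambda(L)$ and $\Lambda(L')$ have disjoint differences. 5. $\Lambda(L)\oplus\Lambda(L')=\mathbb Z$ if and only if, whenever $a_0,\dots,a_{r-1}$ are the digits of an extreme cycle for $(B\oplus B',L\oplus L')$, the sequence $p(a_0),\dots,p(a_{r-1})$ consists of the digits of an extreme cycle for $(B,L)$ and $p'(a_0),\dots,p'(a_{r-1})$ consists of the digits of an extreme cycle for $(B',L')$. Moreover, the equality $\Lambda(L)\oplus\Lambda(L')=\mathbb Z$ holds if and only if the translates $\Lambda(L)+\lambda'$, $\lambda'\in\Lambda(L')$, form a partition of $\mathbb Z$. -/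

import Mathlib

open MeasureTheory
open scoped Pointwise ENNReal

noncomputable section

namespace HadamardTiling

/-! ### The affine iterated function system with scaling factor `R` and digits `B` -/

/-- The contraction `τ_b(x) = R⁻¹ (x + b)`. -/
def tau (R : ℕ) (b : ℤ) (x : ℝ) : ℝ := (R : ℝ)⁻¹ * (x + b)

/-- The real number `∑_{k ≥ 1} R^{-k} b_k` coded by a sequence of digits in `B`. -/
def codedPoint (R : ℕ) (B : Finset ℤ) (d : ℕ → B) : ℝ :=
  ∑' k : ℕ, ((d k : ℤ) : ℝ) * ((R : ℝ)⁻¹) ^ (k + 1)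

/-- The attractor `X_B = { ∑_{k ≥ 1} R^{-k} b_k : b_k ∈ B }`. -/
def attractor (R : ℕ) (B : Finset ℤ) : Set ℝ := Set.range (codedPoint R B)

/-- `μ` is an invariant measure of the system: a Borel probability measure with
`μ(E) = (1/N) ∑_{b ∈ B} μ(τ_b⁻¹ E)` for all Borel sets `E`, where `N = #B`. -/
def IsInvariantMeasure (R : ℕ) (B : Finset ℤ) (μ : Measure ℝ) : Prop :=
  IsProbabilityMeasure μ ∧
    ∀ E : Set ℝ, MeasurableSet E →
      μ E = (B.card : ℝ≥0∞)⁻¹ * ∑ b ∈ B, μ (tau R b ⁻¹' E)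

open Classical in
/-- The invariant measure `μ_B`. Existence and uniqueness for `R ≥ 2` and nonempty `B` are proved
below (`existsUnique_isInvariantMeasure`); the value `0` is used only when there is none. -/
def invariantMeasure (R : ℕ) (B : Finset ℤ) : Measure ℝ :=
  if h : ∃ μ : Measure ℝ, IsInvariantMeasure R B μ then h.choose else 0

instance (R : ℕ) (B : Finset ℤ) : IsFiniteMeasure (invariantMeasure R B) := by
  unfold invariantMeasure
  split_ifs with h
  · have := h.choose_spec.1
    infer_instance
  · infer_instance

/-! ### Hadamard pairs and extreme cycles -/

/-- The matrix `(1/√N) (e^{2πi R⁻¹ b l})_{b ∈ B, l ∈ L}` with `N = #B`. -/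
def hadamardMatrix (R : ℕ) (B L : Finset ℤ) : Matrix B L ℂ := fun b l =>
  ((Real.sqrt (B.card : ℝ) : ℝ) : ℂ)⁻¹ *
    Complex.exp (2 * Real.pi * Complex.I * ((b : ℤ) : ℂ) * ((l : ℤ) : ℂ) / (R : ℂ))

/-- `(B, L)` is a Hadamard pair with scaling factor `R`. -/
structure IsHadamardPair (R : ℕ) (B L : Finset ℤ) : Prop where
  zero_mem_left : (0 : ℤ) ∈ B
  zero_mem_right : (0 : ℤ) ∈ L
  card_eq : L.card = B.card
  unitary_left : (hadamardMatrix R B L).conjTranspose * hadamardMatrix R B L = 1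
  unitary_right : hadamardMatrix R B L * (hadamardMatrix R B L).conjTranspose = 1

/-- The function `m_B(x) = (1/N) ∑_{b ∈ B} e^{2πi b x}`. -/
def maskFn (B : Finset ℤ) (x : ℝ) : ℂ :=
  (B.card : ℂ)⁻¹ * ∑ b ∈ B, Complex.exp (2 * Real.pi * Complex.I * (b : ℂ) * (x : ℂ))

/-- The points `x_0, …, x_{r-1}` form a cycle for `L` with digits `l_0, …, l_{r-1}`:
`(x_k + l_k)/R = x_{k+1}` for all `k`, where indices are taken modulo `r`
(addition in `Fin r` is modulo `r`). The points need not be distinct. -/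
def IsCycle (R : ℕ) (L : Finset ℤ) {r : ℕ} [NeZero r] (x : Fin r → ℝ) (l : Fin r → ℤ) : Prop :=
  ∀ k : Fin r, l k ∈ L ∧ (x k + (l k : ℝ)) / (R : ℝ) = x (k + 1)

/-- The cycle is extreme for `(B, L)`: moreover `|m_B(x_k)| = 1` for all `k`. -/
def IsExtremeCycle (R : ℕ) (B L : Finset ℤ) {r : ℕ} [NeZero r] (x : Fin r → ℝ) (l : Fin r → ℤ) :
    Prop :=
  IsCycle R L x l ∧ ∀ k : Fin r, ‖maskFn B (x k)‖ = 1

/-- `l_0, …, l_{r-1}` are the digits of an extreme cycle for `(B, L)`. -/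
def IsExtremeCycleDigits (R : ℕ) (B L : Finset ℤ) {r : ℕ} [NeZero r] (l : Fin r → ℤ) : Prop :=
  ∃ x : Fin r → ℝ, IsExtremeCycle R B L x l

/-! ### Disjoint differences, complementary pairs, base `R` representations -/

/-- `A` and `A'` have disjoint differences: `(A - A) ∩ (A' - A') = {0}`. -/
def DisjointDifferences (A A' : Set ℤ) : Prop := (A - A) ∩ (A' - A') = {0}

/-- `A ⊕ A' = S`: the sets have disjoint differences and their sum is `S`. -/
def IsDirectSum (A A' S : Set ℤ) : Prop := DisjointDifferences A A' ∧ A + A' = S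

/-- `A` tiles `ℤ` by `T`: the translates `A + t`, `t ∈ T`, are a partition of `ℤ`. -/
def TilesIntegersBy (A T : Set ℤ) : Prop :=
  (⋃ t ∈ T, t +ᵥ A) = Set.univ ∧ T.PairwiseDisjoint (fun t => t +ᵥ A)

/-- `S` is a complete set of representatives modulo `R`. -/
def IsCompleteResidueSet (R : ℕ) (S : Set ℤ) : Prop :=
  ∀ n : ℤ, ∃! s : ℤ, s ∈ S ∧ s ≡ n [ZMOD (R : ℤ)]

/-- `(B, L)` and `(B', L')` are complementary Hadamard pairs with scaling factor `R`. -/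
structure AreComplementary (R : ℕ) (B L B' L' : Finset ℤ) : Prop where
  pair : IsHadamardPair R B L
  pair' : IsHadamardPair R B' L'
  disjointDifferences_B : DisjointDifferences (B : Set ℤ) (B' : Set ℤ)
  complete_B : IsCompleteResidueSet R ((B : Set ℤ) + (B' : Set ℤ))
  disjointDifferences_L : DisjointDifferences (L : Set ℤ) (L' : Set ℤ)
  complete_L : IsCompleteResidueSet R ((L : Set ℤ) + (L' : Set ℤ))
  integer_cycles : ∀ (r : ℕ) [NeZero r] (x : Fin r → ℝ) (l : Fin r → ℤ),
    IsExtremeCycle R B L x l → ∀ k, ∃ n : ℤ, x k = n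
  integer_cycles' : ∀ (r : ℕ) [NeZero r] (x : Fin r → ℝ) (l : Fin r → ℤ),
    IsExtremeCycle R B' L' x l → ∀ k, ∃ n : ℤ, x k = n
  gcd_eq_one : (B + B').gcd id = 1

/-- `Λ(L)`: the integers `x` that can be represented in base `R` using digits in `L`, that is,
`x_0 = x` and `x_k = R x_{k+1} + l_k` for some integers `x_k` and digits `l_k ∈ L`. -/
def representable (R : ℕ) (L : Finset ℤ) : Set ℤ :=
  {x | ∃ (y : ℕ → ℤ) (l : ℕ → ℤ), y 0 = x ∧
    ∀ k, l k ∈ L ∧ y k = (R : ℤ) * y (k + 1) + l k}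

open Classical in
/-- The map `p : L ⊕ L' → L`, `p(l + l') = l` (see `projLeft_add`), extended by `0`. -/
def projLeft (L L' : Finset ℤ) (a : ℤ) : ℤ :=
  if h : ∃ l ∈ L, ∃ l' ∈ L', l + l' = a then h.choose else 0

/-- The map `p' : L ⊕ L' → L'`, `p'(l + l') = l'` (see `projRight_add`). -/
def projRight (L L' : Finset ℤ) (a : ℤ) : ℤ := a - projLeft L L' a

theorem projLeft_add {L L' : Finset ℤ} (h : DisjointDifferences (L : Set ℤ) (L' : Set ℤ))
    {l l' : ℤ} (hl : l ∈ L) (hl' : l' ∈ L') : projLeft L L' (l + l') = l := by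
  have hex : ∃ m ∈ L, ∃ m' ∈ L', m + m' = l + l' := ⟨l, hl, l', hl', rfl⟩
  unfold projLeft
  rw [dif_pos hex]
  obtain ⟨hm, m', hm', e⟩ := hex.choose_spec
  have hz : hex.choose - l ∈ ({0} : Set ℤ) := by
    rw [← h]
    refine ⟨Set.sub_mem_sub (by simpa using hm) (by simpa using hl), ?_⟩
    have : hex.choose - l = l' - m' := by linarith
    rw [this]
    exact Set.sub_mem_sub (by simpa using hl') (by simpa using hm')
  have : hex.choose - l = 0 := hz
  linarith

theorem projRight_add {L L' : Finset ℤ} (h : DisjointDifferences (L : Set ℤ) (L' : Set ℤ))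
    {l l' : ℤ} (hl : l ∈ L) (hl' : l' ∈ L') : projRight L L' (l + l') = l' := by
  simp [projRight, projLeft_add h hl hl']

/-! ### Spectra and translation congruence -/

/-- The exponential `e_λ(x) = e^{2πi λ x}`. -/
def expFn (lam : ℝ) (x : ℝ) : ℂ := Complex.exp (2 * Real.pi * Complex.I * (lam : ℂ) * (x : ℂ))

theorem memLp_expFn (μ : Measure ℝ) [IsFiniteMeasure μ] (lam : ℝ) : MemLp (expFn lam) 2 μ := by
  refine MemLp.of_bound (C := 1) ?_ ?_
  · exact Continuous.aestronglyMeasurable (by unfold expFn; fun_prop)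
  · refine Filter.Eventually.of_forall fun x => ?_
    have : (2 * Real.pi * Complex.I * (lam : ℂ) * (x : ℂ)) =
        ((2 * Real.pi * lam * x : ℝ) : ℂ) * Complex.I := by
      push_cast
      ring
    rw [expFn, this, Complex.norm_exp_ofReal_mul_I]

/-- `e_λ` as an element of `L²(μ)`. -/
def expLp (μ : Measure ℝ) [IsFiniteMeasure μ] (lam : ℝ) : Lp ℂ 2 μ :=
  (memLp_expFn μ lam).toLp (expFn lam)

/-- `Λ` is a spectrum for the finite Borel measure `μ`: the family `{e_λ : λ ∈ Λ}` is an orthogonal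
basis for `L²(μ)`. -/
def IsSpectrum (μ : Measure ℝ) [IsFiniteMeasure μ] (Λ : Set ℝ) : Prop :=
  Λ.Pairwise (fun s t => inner ℂ (expLp μ s) (expLp μ t) = 0) ∧
    (Submodule.span ℂ (expLp μ '' Λ)).topologicalClosure = ⊤

/-- The sets `A_n`, `n ∈ ℤ`, form a measurable partition of `S`, up to Lebesgue measure zero. -/
def IsAEPartition (A : ℤ → Set ℝ) (S : Set ℝ) : Prop :=
  (∀ n, MeasurableSet (A n)) ∧ Pairwise (fun m n => AEDisjoint volume (A m) (A n)) ∧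
    (⋃ n, A n) =ᵐ[volume] S

/-- `X` is translation congruent to `Y`: there is a measurable partition `{A_n}` of `Y` such that
`{A_n + n}` is a measurable partition of `X`, up to Lebesgue measure zero. -/
def TranslationCongruent (X Y : Set ℝ) : Prop :=
  ∃ A : ℤ → Set ℝ, IsAEPartition A Y ∧ IsAEPartition (fun n => (n : ℝ) +ᵥ A n) X

/-! ### The attractor and the invariant measure are the standard ones -/

theorem norm_term_le {R : ℕ} (B : Finset ℤ) (d : ℕ → B) (k : ℕ) :
    ‖((d k : ℤ) : ℝ) * ((R : ℝ)⁻¹) ^ (k + 1)‖ ≤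
      (∑ b ∈ B, ‖(b : ℝ)‖) * ((R : ℝ)⁻¹) ^ (k + 1) := by
  rw [norm_mul, norm_pow, norm_inv, Real.norm_natCast]
  gcongr
  exact Finset.single_le_sum (f := fun b : ℤ => ‖(b : ℝ)‖) (fun _ _ => norm_nonneg _) (d k).2

theorem summable_bound {R : ℕ} (hR : 2 ≤ R) (B : Finset ℤ) :
    Summable fun k : ℕ => (∑ b ∈ B, ‖(b : ℝ)‖) * ((R : ℝ)⁻¹) ^ (k + 1) := by
  have hR' : (1 : ℝ) < R := by exact_mod_cast hR
  refine Summable.mul_left _ ?_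
  exact (summable_nat_add_iff 1).2
    (summable_geometric_of_lt_one (by positivity) (inv_lt_one_of_one_lt₀ hR'))

theorem summable_term {R : ℕ} (hR : 2 ≤ R) (B : Finset ℤ) (d : ℕ → B) :
    Summable fun k : ℕ => ((d k : ℤ) : ℝ) * ((R : ℝ)⁻¹) ^ (k + 1) :=
  Summable.of_norm_bounded (summable_bound hR B) (norm_term_le B d)

theorem continuous_codedPoint {R : ℕ} (hR : 2 ≤ R) (B : Finset ℤ) :
    Continuous (codedPoint R B) := by
  refine continuous_tsum (fun k => ?_) (summable_bound hR B) (fun k d => norm_term_le B d k)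
  have : Continuous fun b : B => ((b : ℤ) : ℝ) := continuous_of_discreteTopology
  fun_prop

theorem codedPoint_eq {R : ℕ} (hR : 2 ≤ R) (B : Finset ℤ) (d : ℕ → B) :
    codedPoint R B d = tau R (d 0) (codedPoint R B fun k => d (k + 1)) := by
  unfold codedPoint tau
  rw [(summable_term hR B d).tsum_eq_zero_add, mul_add, ← tsum_mul_left, add_comm]
  congr 1
  · congr 1
    ext k
    ring
  · ring

/-- `X_B` is a nonempty compact set with `X_B = ⋃_b τ_b(X_B)`. -/
theorem isCompact_attractor {R : ℕ} (hR : 2 ≤ R) {B : Finset ℤ} (hB : B.Nonempty) :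
    (attractor R B).Nonempty ∧ IsCompact (attractor R B) ∧
      attractor R B = ⋃ b ∈ B, tau R b '' attractor R B := by
  have : Nonempty B := hB.to_subtype
  refine ⟨Set.range_nonempty _, isCompact_range (continuous_codedPoint hR B), ?_⟩
  ext x
  simp only [Set.mem_iUnion, exists_prop]
  constructor
  · rintro ⟨d, rfl⟩
    exact ⟨d 0, (d 0).2, _, ⟨fun k => d (k + 1), rfl⟩, (codedPoint_eq hR B d).symm⟩
  · rintro ⟨b, hb, _, ⟨d, rfl⟩, rfl⟩
    refine ⟨fun k => Nat.casesOn k ⟨b, hb⟩ d, ?_⟩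
    rw [codedPoint_eq hR]
    rfl

/-- The law of a sequence of independent uniform digits is preserved by prepending one. -/
theorem map_cons_infinitePi {X : Type*} [MeasurableSpace X] (P : Measure X)
    [IsProbabilityMeasure P] :
    (P.prod (Measure.infinitePi fun _ : ℕ => P)).map
      (fun q : X × (ℕ → X) => fun k : ℕ => Nat.casesOn (motive := fun _ => X) k q.1 q.2) =
      Measure.infinitePi fun _ : ℕ => P := by
  have hm : Measurable
      (fun q : X × (ℕ → X) => fun k : ℕ => Nat.casesOn (motive := fun _ => X) k q.1 q.2) := by
    refine measurable_pi_lambda _ fun k => ?_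
    cases k with
    | zero => exact measurable_fst
    | succ k => exact (measurable_pi_apply k).comp measurable_snd
  refine Measure.eq_infinitePi _ fun s t ht => ?_
  classical
  let t' : ℕ → Set X := fun i => if i ∈ s then t i else Set.univ
  have ht' : ∀ i, MeasurableSet (t' i) := by
    intro i
    by_cases hi : i ∈ s
    · simpa [t', hi] using ht i
    · simp [t', hi]
  have hs : s ⊆ Finset.range (s.sup id + 1) := s.subset_range_sup_succ
  set n := s.sup id with hn
  have hbox : (s : Set ℕ).pi t = ((Finset.range (n + 1) : Finset ℕ) : Set ℕ).pi t' := by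
    ext f
    simp only [Set.mem_pi, Finset.mem_coe]
    constructor
    · intro h i _
      by_cases hi : i ∈ s
      · simpa [t', hi] using h i hi
      · simp [t', hi]
    · intro h i hi
      simpa [t', hi] using h i (hs hi)
  have hprod : ∏ i ∈ s, P (t i) = ∏ i ∈ Finset.range (n + 1), P (t' i) := by
    rw [← Finset.prod_subset hs]
    · exact Finset.prod_congr rfl fun i hi => by simp [t', hi]
    · intro i _ hi
      simp [t', hi]
  rw [hbox, hprod, Finset.prod_range_succ',
    Measure.map_apply hm (MeasurableSet.pi (Finset.countable_toSet _) fun i _ => ht' i)]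
  have hpre : (fun q : X × (ℕ → X) => fun k : ℕ =>
      Nat.casesOn (motive := fun _ => X) k q.1 q.2) ⁻¹'
        ((Finset.range (n + 1) : Finset ℕ) : Set ℕ).pi t' =
      t' 0 ×ˢ ((Finset.range n : Finset ℕ) : Set ℕ).pi (fun k => t' (k + 1)) := by
    ext q
    simp only [Set.mem_preimage, Set.mem_pi, Finset.mem_coe, Finset.mem_range, Set.mem_prod]
    constructor
    · intro h
      exact ⟨h 0 (by omega), fun i hi => h (i + 1) (by omega)⟩
    · rintro ⟨h0, h1⟩ i hi
      cases i with
      | zero => exact h0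
      | succ i => exact h1 i (by omega)
  rw [hpre, Measure.prod_prod, Measure.infinitePi_pi _ (fun i _ => ht' (i + 1)), mul_comm]

theorem measurable_tau (R : ℕ) (b : ℤ) : Measurable (tau R b) := by
  unfold tau
  fun_prop

theorem exists_isInvariantMeasure {R : ℕ} (hR : 2 ≤ R) {B : Finset ℤ} (hB : B.Nonempty) :
    ∃ μ : Measure ℝ, IsInvariantMeasure R B μ := by
  have hN : (B.card : ℝ≥0∞) ≠ 0 := by simpa using hB.ne_empty
  have : Nonempty B := hB.to_subtype
  let P : Measure B := (B.card : ℝ≥0∞)⁻¹ • Measure.count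
  have : IsProbabilityMeasure P := ⟨by
    simp [P, Measure.count_univ, ENNReal.inv_mul_cancel hN]⟩
  let Q : Measure (ℕ → B) := Measure.infinitePi fun _ => P
  have hc : Measurable (codedPoint R B) := (continuous_codedPoint hR B).measurable
  refine ⟨Q.map (codedPoint R B), Measure.isProbabilityMeasure_map hc.aemeasurable, ?_⟩
  intro E hE
  have hm : Measurable
      (fun q : B × (ℕ → B) => fun k : ℕ => Nat.casesOn (motive := fun _ => B) k q.1 q.2) := by
    refine measurable_pi_lambda _ fun k => ?_
    cases k with
    | zero => exact measurable_fst
    | succ k => exact (measurable_pi_apply k).comp measurable_snd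
  have hQ := map_cons_infinitePi P
  rw [Measure.map_apply hc hE]
  conv_lhs => rw [show Q = _ from hQ.symm]
  rw [Measure.map_apply hm (hc hE), Measure.prod_apply (hm (hc hE)), lintegral_smul_measure,
    lintegral_count, tsum_fintype, smul_eq_mul]
  congr 1
  rw [← Finset.sum_coe_sort B]
  refine Finset.sum_congr rfl fun b _ => ?_
  rw [Measure.map_apply hc (measurable_tau R b hE)]
  congr 1
  ext d
  simp only [Set.mem_preimage]
  rw [codedPoint_eq hR]
  rfl

theorem charFun_of_isInvariantMeasure {R : ℕ} {B : Finset ℤ} {μ : Measure ℝ}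
    (h : IsInvariantMeasure R B μ) (t : ℝ) :
    charFun μ t = (B.card : ℂ)⁻¹ *
      ∑ b ∈ B, Complex.exp ((t * ((R : ℝ)⁻¹ * b) : ℝ) * Complex.I) *
        charFun μ (t * (R : ℝ)⁻¹) := by
  have := h.1
  have hμ : μ = (B.card : ℝ≥0∞)⁻¹ • ∑ b ∈ B, μ.map (tau R b) := by
    ext E hE
    rw [h.2 E hE, Measure.smul_apply, Measure.finsetSum_apply, smul_eq_mul]
    congr 1
    exact Finset.sum_congr rfl fun b _ => by rw [Measure.map_apply (measurable_tau R b) hE]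
  have hint : ∀ b ∈ B, Integrable (fun x : ℝ => Complex.exp (t * x * Complex.I))
      (μ.map (tau R b)) := by
    intro b _
    have : IsProbabilityMeasure (μ.map (tau R b)) :=
      Measure.isProbabilityMeasure_map (measurable_tau R b).aemeasurable
    refine Integrable.of_bound (C := 1)
      (Continuous.aestronglyMeasurable (by fun_prop)) (Filter.Eventually.of_forall fun x => ?_)
    rw [← Complex.ofReal_mul, Complex.norm_exp_ofReal_mul_I]
  conv_lhs => rw [hμ]
  rw [charFun_apply_real, integral_smul_measure, integral_finsetSum_measure hint]
  simp only [ENNReal.toReal_inv, ENNReal.toReal_natCast, Complex.real_smul, Complex.ofReal_inv,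
    Complex.ofReal_natCast]
  congr 1
  refine Finset.sum_congr rfl fun b _ => ?_
  rw [integral_map (measurable_tau R b).aemeasurable
    (Continuous.aestronglyMeasurable (by fun_prop)), charFun_apply_real, ← integral_const_mul]
  congr 1
  ext x
  rw [← Complex.exp_add]
  congr 1
  unfold tau
  push_cast
  ring

/-- For `R ≥ 2` and nonempty `B` there is exactly one invariant measure. -/
theorem existsUnique_isInvariantMeasure {R : ℕ} (hR : 2 ≤ R) {B : Finset ℤ} (hB : B.Nonempty) :
    ∃! μ : Measure ℝ, IsInvariantMeasure R B μ := by
  obtain ⟨μ, hμ⟩ := exists_isInvariantMeasure hR hB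
  refine ⟨μ, hμ, fun ν hν => ?_⟩
  have := hμ.1
  have := hν.1
  have hR' : (1 : ℝ) < R := by exact_mod_cast hR
  have hN : (B.card : ℝ) ≠ 0 := by simpa using hB.ne_empty
  let D : ℝ → ℂ := fun t => charFun ν t - charFun μ t
  have hstep : ∀ t, ‖D t‖ ≤ ‖D (t * (R : ℝ)⁻¹)‖ := by
    intro t
    have : D t = (B.card : ℂ)⁻¹ *
        ∑ b ∈ B, Complex.exp ((t * ((R : ℝ)⁻¹ * b) : ℝ) * Complex.I) * D (t * (R : ℝ)⁻¹) := by
      simp only [D]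
      rw [charFun_of_isInvariantMeasure hν t, charFun_of_isInvariantMeasure hμ t]
      simp only [mul_sub, Finset.sum_sub_distrib]
    rw [this, norm_mul, norm_inv, Complex.norm_natCast]
    calc (B.card : ℝ)⁻¹ * ‖∑ b ∈ B,
            Complex.exp ((t * ((R : ℝ)⁻¹ * b) : ℝ) * Complex.I) * D (t * (R : ℝ)⁻¹)‖
        ≤ (B.card : ℝ)⁻¹ * ∑ b ∈ B, ‖D (t * (R : ℝ)⁻¹)‖ := by
          gcongr
          refine norm_sum_le_of_le _ fun b _ => ?_
          rw [norm_mul, Complex.norm_exp_ofReal_mul_I, one_mul]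
      _ = ‖D (t * (R : ℝ)⁻¹)‖ := by
          rw [Finset.sum_const, nsmul_eq_mul, inv_mul_cancel_left₀ hN]
  have hiter : ∀ (t : ℝ) (n : ℕ), ‖D t‖ ≤ ‖D (t * ((R : ℝ)⁻¹) ^ n)‖ := by
    intro t n
    induction n with
    | zero => simp
    | succ n ih =>
      refine ih.trans ((hstep _).trans_eq ?_)
      rw [mul_assoc, ← pow_succ]
  have hcont : Continuous D := by
    have key : ∀ (ρ : Measure ℝ) [IsProbabilityMeasure ρ], Continuous (charFun ρ) := by
      intro ρ _
      simp only [funext fun t => charFun_apply_real (μ := ρ) t]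
      refine continuous_of_dominated (bound := fun _ => 1) (fun t => ?_) (fun t => ?_)
        (integrable_const _) (Filter.Eventually.of_forall fun x => by fun_prop)
      · exact Continuous.aestronglyMeasurable (by fun_prop)
      · refine Filter.Eventually.of_forall fun x => ?_
        rw [← Complex.ofReal_mul, Complex.norm_exp_ofReal_mul_I]
    exact (key ν).sub (key μ)
  refine Measure.ext_of_charFun (funext fun t => ?_)
  have hlim : Filter.Tendsto (fun n : ℕ => ‖D (t * ((R : ℝ)⁻¹) ^ n)‖) Filter.atTop
      (nhds ‖D (t * 0)‖) := by
    refine (hcont.norm.tendsto _).comp (Filter.Tendsto.const_mul t ?_)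
    exact tendsto_pow_atTop_nhds_zero_of_lt_one (by positivity) (inv_lt_one_of_one_lt₀ hR')
  have h0 : ‖D (t * 0)‖ = 0 := by simp [D]
  rw [h0] at hlim
  have : ‖D t‖ ≤ 0 := ge_of_tendsto' hlim (hiter t)
  exact sub_eq_zero.1 (norm_le_zero_iff.1 this)

theorem isInvariantMeasure_invariantMeasure {R : ℕ} (hR : 2 ≤ R) {B : Finset ℤ}
    (hB : B.Nonempty) : IsInvariantMeasure R B (invariantMeasure R B) := by
  have h := exists_isInvariantMeasure hR hB
  unfold invariantMeasure
  rw [dif_pos h]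
  exact h.choose_spec

end HadamardTiling

end

open MeasureTheory
open scoped Pointwise ENNReal

noncomputable section

namespace HadamardTiling

/-! ### Base `R` expansions of integers -/

/-! The analytic core is one criterion, `IsHadamardPair.isSpectrum`: if the extreme cycles of a
Hadamard pair (B, L) consist of integers, then Λ = Λ(L) is a spectrum of μ = μ_B. Orthogonality
follows from the refinement equation μ̂(t) = m_B(t/R) μ̂(t/R), applied digit by digit. For
completeness let H(t) be the squared norm of the projection of e_{-t} to the closed span of {e_λ : λ
∈ Λ}. Parseval gives H(t) = ∑ |μ̂(t+λ)|², and splitting Λ into the disjoint sets RΛ + l gives H(t) =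
∑_l |m_B((t+l)/R)|² H((t+l)/R), with weights of sum 1 by unitarity. Bounded support of μ makes H
real analytic. On a compact interval preserved by the maps t ↦ (t+l)/R, a minimum of H propagates
along all transitions of nonzero weight. If the set of minimum points is infinite, H is constant,
equal to H(0) ≥ 1; if finite, it contains an extreme cycle (`exists_isExtremeCycle_of_finite`),
whose points are negatives of elements of Λ, where H ≥ 1. So every exponential lies in the closed
span, and exponentials are total in L²(μ).

The criterion applies to each given pair, and also to (B ⊕ B', L ⊕ L'): complete residue systems
give a Fourier matrix, the gcd condition makes extreme cycle points integers
(`exists_eq_intCast_of_norm_maskFn_eq_one`), and every integer is representable. Hence ℤ is a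
spectrum of μ_{B⊕B'}. By uniqueness this measure is normalized Lebesgue measure on the attractor X.
The integer translates of X cover the line, and the spectrum ℤ forbids overlaps of positive measure,
so X is congruent to [0,1] and has measure 1. The convolution formula is also an instance of
uniqueness of the invariant measure.

The statements about Λ(L) ⊕ Λ(L') are arithmetic. An expansion determines and is determined by its
integer, so sums can be compared digit by digit. Quotients of an expansion are eventually periodic,
and periodic integer expansions are, up to sign, extreme cycles; `representable_add_eq_univ_iff`
thereby reduces the covering of ℤ to cycles. -/

/-- The integers `n k` are the successive quotients of an expansion in base `R` with digits `d k`
taken from `L`. -/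
def IsExpansion (R : ℕ) (L : Set ℤ) (n d : ℕ → ℤ) : Prop :=
  ∀ k, d k ∈ L ∧ n k = (R : ℤ) * n (k + 1) + d k

/-- The elements of `S` are pairwise incongruent modulo `R`. -/
def Incongruent (R : ℕ) (S : Set ℤ) : Prop :=
  ∀ s ∈ S, ∀ t ∈ S, (R : ℤ) ∣ s - t → s = t

theorem IsCompleteResidueSet.incongruent {R : ℕ} {S : Set ℤ} (h : IsCompleteResidueSet R S) :
    Incongruent R S := by
  intro s hs t ht hst
  obtain ⟨u, -, hu⟩ := h t
  rw [hu s ⟨hs, ((Int.modEq_iff_dvd).2 hst).symm⟩, hu t ⟨ht, rfl⟩]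

theorem mem_representable_iff {R : ℕ} {L : Finset ℤ} {x : ℤ} :
    x ∈ representable R L ↔ ∃ n d, IsExpansion R L n d ∧ n 0 = x :=
  ⟨fun ⟨n, d, h0, h⟩ => ⟨n, d, h, h0⟩, fun ⟨n, d, h, h0⟩ => ⟨n, d, h0, h⟩⟩

theorem IsExpansion.shift {R : ℕ} {L : Set ℤ} {n d : ℕ → ℤ} (h : IsExpansion R L n d) (i : ℕ) :
    IsExpansion R L (fun k => n (i + k)) (fun k => d (i + k)) := fun k => h (i + k)

theorem IsExpansion.mem_representable {R : ℕ} {L : Finset ℤ} {n d : ℕ → ℤ}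
    (h : IsExpansion R L n d) (k : ℕ) : n k ∈ representable R L :=
  mem_representable_iff.2 ⟨_, _, h.shift k, rfl⟩

theorem mul_add_mem_representable {R : ℕ} {L : Finset ℤ} {x l : ℤ}
    (hx : x ∈ representable R L) (hl : l ∈ L) : (R : ℤ) * x + l ∈ representable R L := by
  obtain ⟨n, d, h, rfl⟩ := mem_representable_iff.1 hx
  refine mem_representable_iff.2 ⟨fun k => Nat.casesOn k ((R : ℤ) * n 0 + l) n,
    fun k => Nat.casesOn k l d, fun k => ?_, rfl⟩
  cases k with
  | zero => exact ⟨hl, rfl⟩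
  | succ k => exact h k

theorem exists_of_mem_representable {R : ℕ} {L : Finset ℤ} {x : ℤ} (hx : x ∈ representable R L) :
    ∃ l ∈ L, ∃ y ∈ representable R L, x = (R : ℤ) * y + l := by
  obtain ⟨n, d, h, rfl⟩ := mem_representable_iff.1 hx
  exact ⟨d 0, (h 0).1, n 1, h.mem_representable 1, (h 0).2⟩

theorem zero_mem_representable {R : ℕ} {L : Finset ℤ} (hL : (0 : ℤ) ∈ L) :
    (0 : ℤ) ∈ representable R L :=
  mem_representable_iff.2 ⟨fun _ => 0, fun _ => 0, fun _ => ⟨hL, by simp⟩, rfl⟩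

/-- Every power of R divides `n 0`, and the power with exponent |n 0| already exceeds |n 0|. Hence a
digit sequence determines its integer even when the expansion never terminates. -/
theorem eq_zero_of_forall_eq_mul {R : ℕ} (hR : 2 ≤ R) {n : ℕ → ℤ}
    (h : ∀ k, n k = (R : ℤ) * n (k + 1)) : n 0 = 0 := by
  have hpow : ∀ k, n 0 = (R : ℤ) ^ k * n k := by
    intro k
    induction k with
    | zero => simp
    | succ k ih => rw [ih, h k]; ring
  refine Int.eq_zero_of_abs_lt_dvd (m := (R : ℤ) ^ (n 0).natAbs) ⟨_, hpow _⟩ ?_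
  rw [Int.abs_eq_natAbs]
  exact_mod_cast (n 0).natAbs.lt_pow_self (by omega)

theorem IsExpansion.eq_of_digits_eq {R : ℕ} (hR : 2 ≤ R) {L L' : Set ℤ} {n n' d : ℕ → ℤ}
    (h : IsExpansion R L n d) (h' : IsExpansion R L' n' d) : n 0 = n' 0 := by
  have := eq_zero_of_forall_eq_mul hR (n := fun k => n k - n' k) fun k => by
    rw [(h k).2, (h' k).2]
    ring
  exact sub_eq_zero.1 this

theorem IsExpansion.digits_eq {R : ℕ} (hR : 2 ≤ R) {L : Set ℤ} (hL : Incongruent R L)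
    {n n' d d' : ℕ → ℤ} (h : IsExpansion R L n d) (h' : IsExpansion R L n' d')
    (h0 : n 0 = n' 0) (k : ℕ) : d k = d' k := by
  have step : ∀ k, n k = n' k → d k = d' k ∧ n (k + 1) = n' (k + 1) := by
    intro k hk
    have e1 := (h k).2
    have e2 := (h' k).2
    have hd : d k = d' k := hL _ (h k).1 _ (h' k).1 ⟨n' (k + 1) - n (k + 1), by linarith⟩
    refine ⟨hd, ?_⟩
    have : (R : ℤ) ≠ 0 := by positivity
    exact mul_left_cancel₀ this (by linarith)
  have hn : ∀ k, n k = n' k := by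
    intro k
    induction k with
    | zero => exact h0
    | succ k ih => exact (step k ih).2
  exact (step k (hn k)).1

/-- Division with remainder, the remainder being taken in `S`; the quotients are iterated. -/
theorem representable_eq_univ {R : ℕ} {S : Finset ℤ} (h : IsCompleteResidueSet R (S : Set ℤ)) :
    representable R S = Set.univ := by
  refine Set.eq_univ_of_forall fun x => ?_
  have hex : ∀ y : ℤ, ∃ q : ℤ × ℤ, q.2 ∈ S ∧ y = (R : ℤ) * q.1 + q.2 := by
    intro y
    obtain ⟨s, ⟨hs, hsy⟩, -⟩ := h y
    obtain ⟨q, hq⟩ := hsy.dvd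
    exact ⟨(q, s), by simpa using hs, by simp only; linarith⟩
  choose f hf using hex
  refine mem_representable_iff.2 ⟨fun k => (fun y => (f y).1)^[k] x,
    fun k => (f ((fun y => (f y).1)^[k] x)).2, fun k => ⟨(hf _).1, ?_⟩, rfl⟩
  simp only [Function.iterate_succ_apply']
  exact (hf _).2

theorem disjointDifferences_iff {A A' : Set ℤ} (hA : A.Nonempty) (hA' : A'.Nonempty) :
    DisjointDifferences A A' ↔
      ∀ a ∈ A, ∀ b ∈ A, ∀ a' ∈ A', ∀ b' ∈ A', a + a' = b + b' → a = b := by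
  constructor
  · intro h a ha b hb a' ha' b' hb' e
    have : a - b ∈ ({0} : Set ℤ) := by
      rw [← h]
      refine ⟨Set.sub_mem_sub ha hb, ?_⟩
      rw [show a - b = b' - a' by linarith]
      exact Set.sub_mem_sub hb' ha'
    exact sub_eq_zero.1 this
  · intro h
    refine Set.Subset.antisymm ?_ ?_
    · rintro _ ⟨⟨a, ha, b, hb, rfl⟩, ⟨b', hb', a', ha', e⟩⟩
      simp only at e
      exact sub_eq_zero.2 (h a ha b hb a' ha' b' hb' (by linarith))
    · rintro _ rfl
      obtain ⟨a, ha⟩ := hA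
      obtain ⟨a', ha'⟩ := hA'
      exact ⟨⟨a, ha, a, ha, by simp⟩, ⟨a', ha', a', ha', by simp⟩⟩

/-- Expansions over `L` and `L'` add digit by digit to an expansion over the incongruent set L + L',
whose digits are unique. Disjoint differences then separate each digit into its two parts. -/
theorem disjointDifferences_representable {R : ℕ} (hR : 2 ≤ R) {L L' : Finset ℤ}
    (h0 : (0 : ℤ) ∈ L) (h0' : (0 : ℤ) ∈ L')
    (hd : DisjointDifferences (L : Set ℤ) (L' : Set ℤ))
    (hc : Incongruent R ((L : Set ℤ) + (L' : Set ℤ))) :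
    DisjointDifferences (representable R L) (representable R L') := by
  rw [disjointDifferences_iff ⟨0, zero_mem_representable h0⟩ ⟨0, zero_mem_representable h0'⟩]
  rw [disjointDifferences_iff ⟨0, by simpa using h0⟩ ⟨0, by simpa using h0'⟩] at hd
  rintro a ha b hb a' ha' b' hb' e
  obtain ⟨n, d, hn, rfl⟩ := mem_representable_iff.1 ha
  obtain ⟨m, c, hm, rfl⟩ := mem_representable_iff.1 hb
  obtain ⟨n', d', hn', rfl⟩ := mem_representable_iff.1 ha'
  obtain ⟨m', c', hm', rfl⟩ := mem_representable_iff.1 hb'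
  have add : ∀ {n d n' d' : ℕ → ℤ}, IsExpansion R L n d → IsExpansion R L' n' d' →
      IsExpansion R ((L : Set ℤ) + (L' : Set ℤ)) (fun k => n k + n' k) (fun k => d k + d' k) :=
    fun h h' k => ⟨Set.add_mem_add (h k).1 (h' k).1, by simp only; rw [(h k).2, (h' k).2]; ring⟩
  have hdig := (add hn hn').digits_eq hR hc (add hm hm') e
  have : d = c := funext fun k =>
    hd _ (hn k).1 _ (hm k).1 _ (hn' k).1 _ (hm' k).1 (hdig k)
  subst this
  exact hn.eq_of_digits_eq hR hm

/-! ### Cycles of integers -/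

/-- The relation x_k + l_k = R x_{k+1} becomes the division step of an expansion after negating the
points, so integer cycles are the negatives of periodic expansions. -/
theorem IsCycle.exists_isExpansion {R : ℕ} (hR : 2 ≤ R) {L : Finset ℤ} {r : ℕ} [NeZero r]
    {x : Fin r → ℝ} {l : Fin r → ℤ} (h : IsCycle R L x l) (hx : ∀ k, ∃ n : ℤ, x k = n) :
    ∃ n : ℕ → ℤ, (∀ k, x (Fin.ofNat r k) = -n k) ∧
      IsExpansion R L n (fun k => l (Fin.ofNat r k)) := by
  choose m hm using hx
  have hR0 : (R : ℝ) ≠ 0 := by positivity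
  refine ⟨fun k => -m (Fin.ofNat r k), fun k => by simp [hm], fun k => ⟨(h _).1, ?_⟩⟩
  have hk := (h (Fin.ofNat r k)).2
  have hs : Fin.ofNat r k + 1 = Fin.ofNat r (k + 1) := by
    ext
    simp [Fin.val_add, Fin.ofNat]
  rw [hs, hm, hm, div_eq_iff hR0] at hk
  have : m (Fin.ofNat r k) + l (Fin.ofNat r k) = m (Fin.ofNat r (k + 1)) * R := by
    exact_mod_cast hk
  simp only
  linarith

theorem isCycle_of_periodic {R : ℕ} {L : Finset ℤ} {r : ℕ} [NeZero r] {x : ℕ → ℝ}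
    {d : ℕ → ℤ} (h : ∀ k, d k ∈ L ∧ (x k + d k) / R = x (k + 1)) (hr : x r = x 0) :
    IsCycle R L (fun k : Fin r => x k) (fun k => d k) := by
  intro k
  refine ⟨(h k).1, ?_⟩
  rw [(h k).2]
  by_cases hk : (k : ℕ) + 1 < r
  · congr 1
    rw [Fin.val_add, Fin.val_one', Nat.add_mod_mod, Nat.mod_eq_of_lt hk]
  · have hk' : (k : ℕ) + 1 = r := by omega
    simp only
    rw [hk', hr, Fin.val_add, Fin.val_one', Nat.add_mod_mod, hk', Nat.mod_self]

theorem IsExpansion.isCycle {R : ℕ} (hR : 2 ≤ R) {L : Finset ℤ} {r : ℕ} [NeZero r] {n d : ℕ → ℤ}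
    (h : IsExpansion R L n d) (hr : n r = n 0) :
    IsCycle R L (fun k : Fin r => -(n k : ℝ)) (fun k => d k) := by
  have hR0 : (R : ℝ) ≠ 0 := by positivity
  refine isCycle_of_periodic (x := fun k => -(n k : ℝ)) (fun k => ⟨(h k).1, ?_⟩) (by simp [hr])
  rw [div_eq_iff hR0, (h k).2]
  push_cast
  ring

theorem maskFn_intCast {B : Finset ℤ} (hB : B.Nonempty) (n : ℤ) : maskFn B n = 1 := by
  have : ∀ b ∈ B, Complex.exp (2 * Real.pi * Complex.I * (b : ℂ) * ((n : ℝ) : ℂ)) = 1 := by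
    intro b _
    rw [Complex.exp_eq_one_iff]
    exact ⟨b * n, by push_cast; ring⟩
  rw [maskFn, Finset.sum_congr rfl this, Finset.sum_const, nsmul_eq_mul, mul_one,
    inv_mul_cancel₀]
  simpa using hB.ne_empty

theorem IsExpansion.isExtremeCycle {R : ℕ} (hR : 2 ≤ R) {B L : Finset ℤ} (hB : B.Nonempty) {r : ℕ}
    [NeZero r] {n d : ℕ → ℤ} (h : IsExpansion R L n d) (hr : n r = n 0) :
    IsExtremeCycle R B L (fun k : Fin r => -(n k : ℝ)) (fun k => d k) := by
  refine ⟨h.isCycle hR hr, fun k => ?_⟩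
  simp only
  rw [← Int.cast_neg, maskFn_intCast hB, norm_one]

theorem IsExpansion.abs_le_max {R : ℕ} (hR : 2 ≤ R) {L : Set ℤ} {C : ℤ} (hC : ∀ l ∈ L, |l| ≤ C)
    {n d : ℕ → ℤ} (h : IsExpansion R L n d) (k : ℕ) : |n k| ≤ max |n 0| C := by
  induction k with
  | zero => simp
  | succ k ih =>
    have h1 := hC _ (h k).1
    have h2 : |(R : ℤ) * n (k + 1)| ≤ |n k| + |d k| := by
      rw [show (R : ℤ) * n (k + 1) = n k - d k by rw [(h k).2]; ring]
      exact abs_sub _ _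
    rw [abs_mul, Nat.abs_cast] at h2
    have h3 : 2 * |n (k + 1)| ≤ R * |n (k + 1)| := by
      gcongr
      exact_mod_cast hR
    have h4 : C ≤ max |n 0| C := le_max_right _ _
    linarith

/-- The quotients stay bounded, because dividing by R ≥ 2 absorbs the digit; two of them coincide by
pigeonhole. -/
theorem IsExpansion.exists_eq {R : ℕ} (hR : 2 ≤ R) {L : Finset ℤ} {n d : ℕ → ℤ}
    (h : IsExpansion R L n d) : ∃ i r, r ≠ 0 ∧ n (i + r) = n i := by
  have hC : ∀ l ∈ (L : Set ℤ), |l| ≤ ∑ l ∈ L, |l| := fun l hl =>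
    Finset.single_le_sum (f := fun l : ℤ => |l|) (fun _ _ => abs_nonneg _) hl
  set C := max |n 0| (∑ l ∈ L, |l|)
  have hb : ∀ k, n k ∈ Set.Icc (-C) C := fun k => abs_le.1 (h.abs_le_max hR hC k)
  obtain ⟨i, j, hij, e⟩ := Finite.exists_ne_map_eq_of_infinite
    (fun k => (⟨n k, hb k⟩ : Set.Icc (-C) C))
  have e' : n i = n j := by simpa using e
  rcases lt_or_gt_of_ne hij with hlt | hlt
  · exact ⟨i, j - i, by omega, by rw [e']; congr 1; omega⟩
  · exact ⟨j, i - j, by omega, by rw [← e']; congr 1; omega⟩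

/-! ### Direct sums and tilings of the integers -/

theorem add_eq_univ_iff {A T : Set ℤ} : A + T = Set.univ ↔ (⋃ t ∈ T, t +ᵥ A) = Set.univ := by
  rw [Set.eq_univ_iff_forall, Set.eq_univ_iff_forall]
  refine forall_congr' fun x => ?_
  simp only [Set.mem_add, Set.mem_iUnion, Set.mem_vadd_set, vadd_eq_add, exists_prop]
  constructor
  · rintro ⟨a, ha, t, ht, rfl⟩
    exact ⟨t, ht, a, ha, add_comm _ _⟩
  · rintro ⟨t, ht, a, ha, rfl⟩
    exact ⟨a, ha, t, ht, add_comm _ _⟩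

theorem isDirectSum_univ_iff_tiles {A T : Set ℤ} (h : DisjointDifferences A T) (hA : A.Nonempty)
    (hT : T.Nonempty) : IsDirectSum A T Set.univ ↔ TilesIntegersBy A T := by
  refine ⟨fun hs => ⟨add_eq_univ_iff.1 hs.2, ?_⟩, fun ht => ⟨h, add_eq_univ_iff.2 ht.1⟩⟩
  rw [disjointDifferences_iff hA hT] at h
  intro s hs t ht hst
  refine Set.disjoint_left.2 ?_
  rintro _ ⟨a, ha, rfl⟩ ⟨b, hb, e⟩
  simp only [vadd_eq_add] at e
  have := h a ha b hb s hs t ht (by linarith)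
  exact hst (by linarith)

/-- Both directions compare expansions digit by digit. Every periodic integer expansion is an
extreme cycle, since the mask equals 1 at integers; the integrality hypotheses supply the converse.
-/
theorem representable_add_eq_univ_iff {R : ℕ} (hR : 2 ≤ R) {B L B' L' : Finset ℤ}
    (hB : B.Nonempty) (hB' : B'.Nonempty) (hBB' : (B + B').Nonempty)
    (hd : DisjointDifferences (L : Set ℤ) (L' : Set ℤ))
    (hc : IsCompleteResidueSet R ((L : Set ℤ) + (L' : Set ℤ)))
    (hi : ∀ (r : ℕ) [NeZero r] (x : Fin r → ℝ) (l : Fin r → ℤ),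
      IsExtremeCycle R B L x l → ∀ k, ∃ n : ℤ, x k = n)
    (hi' : ∀ (r : ℕ) [NeZero r] (x : Fin r → ℝ) (l : Fin r → ℤ),
      IsExtremeCycle R B' L' x l → ∀ k, ∃ n : ℤ, x k = n)
    (hi'' : ∀ (r : ℕ) [NeZero r] (x : Fin r → ℝ) (l : Fin r → ℤ),
      IsExtremeCycle R (B + B') (L + L') x l → ∀ k, ∃ n : ℤ, x k = n) :
    representable R L + representable R L' = Set.univ ↔
      ∀ (r : ℕ) [NeZero r] (a : Fin r → ℤ), IsExtremeCycleDigits R (B + B') (L + L') a →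
        IsExtremeCycleDigits R B L (fun k => projLeft L L' (a k)) ∧
          IsExtremeCycleDigits R B' L' (fun k => projRight L L' (a k)) := by
  constructor
  · rintro hsum r _ a ⟨x, hx⟩
    obtain ⟨n, -, hn⟩ := hx.1.exists_isExpansion hR (hi'' r x a hx)
    obtain ⟨y, hy, y', hy', e⟩ : n 0 ∈ representable R L + representable R L' := by simp [hsum]
    obtain ⟨m, d, hm, rfl⟩ := mem_representable_iff.1 hy
    obtain ⟨m', d', hm', rfl⟩ := mem_representable_iff.1 hy'
    have hs : IsExpansion R ((L : Set ℤ) + (L' : Set ℤ)) (fun k => m k + m' k)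
        (fun k => d k + d' k) := fun k =>
      ⟨Set.add_mem_add (hm k).1 (hm' k).1, by simp only; rw [(hm k).2, (hm' k).2]; ring⟩
    rw [Finset.coe_add] at hn
    have hdig := hs.digits_eq hR hc.incongruent hn e
    have hp : ∀ k, projLeft L L' (a (Fin.ofNat r k)) = d k := fun k => by
      rw [← hdig k, projLeft_add hd (hm k).1 (hm' k).1]
    have hp' : ∀ k, projRight L L' (a (Fin.ofNat r k)) = d' k := fun k => by
      rw [← hdig k, projRight_add hd (hm k).1 (hm' k).1]
    have hofr : ∀ k, Fin.ofNat r (r + k) = Fin.ofNat r k := fun k => by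
      ext; simp [Fin.ofNat]
    have hofk : ∀ k : Fin r, Fin.ofNat r k = k := fun k => by
      ext; simp [Fin.ofNat, Nat.mod_eq_of_lt k.2]
    -- The digits of the summands are projections of the cycle's digits, hence periodic; a digit
    -- sequence determines its integer, so the quotients are periodic too.
    have hper : ∀ k, d (r + k) = d k := fun k => by rw [← hp, ← hp, hofr]
    have hper' : ∀ k, d' (r + k) = d' k := fun k => by rw [← hp', ← hp', hofr]
    refine ⟨⟨fun k => -(m k : ℝ), ?_⟩, ⟨fun k => -(m' k : ℝ), ?_⟩⟩
    · have h1 := hm.shift r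
      simp only [hper] at h1
      have h2 : m r = m 0 := h1.eq_of_digits_eq hR hm
      convert hm.isExtremeCycle hR hB h2 using 2 with k
      rw [← hp, hofk]
    · have h1 := hm'.shift r
      simp only [hper'] at h1
      have h2 : m' r = m' 0 := h1.eq_of_digits_eq hR hm'
      convert hm'.isExtremeCycle hR hB' h2 using 2 with k
      rw [← hp', hofk]
  · intro hcyc
    rw [← Finset.coe_add] at hc
    refine Set.eq_univ_of_forall fun x => ?_
    obtain ⟨n, a, hn, rfl⟩ : ∃ n d, IsExpansion R (L + L' : Finset ℤ) n d ∧ n 0 = x :=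
      mem_representable_iff.1 (by simp [representable_eq_univ hc])
    have hsplit : ∀ k, projLeft L L' (a k) ∈ L ∧ projRight L L' (a k) ∈ L' := by
      intro k
      have := (hn k).1
      rw [Finset.coe_add] at this
      obtain ⟨l, hl, l', hl', e⟩ := this
      simp only at e
      rw [← e, projLeft_add hd hl hl', projRight_add hd hl hl']
      exact ⟨hl, hl'⟩
    have hadd : ∀ a, projLeft L L' a + projRight L L' a = a := fun a => by simp [projRight]
    -- Membership in the sum passes from a quotient back to the original integer by restoring
    -- digits, so it suffices to treat a quotient in the periodic part.
    have hdown : ∀ k, n k ∈ representable R L + representable R L' →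
        n 0 ∈ representable R L + representable R L' := by
      intro k
      induction k with
      | zero => exact id
      | succ k ih =>
        rintro ⟨y, hy, y', hy', e⟩
        refine ih ⟨_, mul_add_mem_representable hy (hsplit k).1, _,
          mul_add_mem_representable hy' (hsplit k).2, ?_⟩
        simp only at e ⊢
        rw [(hn k).2, ← e]
        linear_combination hadd (a k)
    obtain ⟨i, r, hr, hper⟩ := hn.exists_eq hR
    have : NeZero r := ⟨hr⟩
    have hx := (hn.shift i).isExtremeCycle (r := r) hR hBB' hper
    obtain ⟨⟨z, hz⟩, ⟨z', hz'⟩⟩ := hcyc r _ ⟨_, hx⟩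
    obtain ⟨p, hp0, hp⟩ := hx.1.exists_isExpansion hR fun k => ⟨-n (i + k), by simp⟩
    obtain ⟨m, -, hm⟩ := hz.1.exists_isExpansion hR (hi r _ _ hz)
    obtain ⟨m', -, hm'⟩ := hz'.1.exists_isExpansion hR (hi' r _ _ hz')
    -- Only the digit sequence matters for comparing with `p`, so no restriction on the digit set is
    -- kept.
    have hs : IsExpansion R Set.univ (fun k => m k + m' k)
        (fun k => a (i + Fin.ofNat r k)) := fun k => by
      refine ⟨trivial, ?_⟩
      simp only
      rw [(hm k).2, (hm' k).2]
      linear_combination hadd (a (i + Fin.ofNat r k))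
    have h1 : p 0 = m 0 + m' 0 := hp.eq_of_digits_eq hR hs
    have h2 : n i = p 0 := by
      have := hp0 0
      simp at this
      exact_mod_cast this
    refine hdown i ⟨m 0, hm.mem_representable 0, m' 0, hm'.mem_representable 0, ?_⟩
    rw [h2, h1]

/-! ### Hadamard pairs -/

theorem norm_exp_two_pi_mul_I (x : ℝ) : ‖Complex.exp (2 * Real.pi * Complex.I * x)‖ = 1 := by
  rw [show 2 * Real.pi * Complex.I * x = ((2 * Real.pi * x : ℝ) : ℂ) * Complex.I by
    push_cast; ring, Complex.norm_exp_ofReal_mul_I]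

theorem conj_exp_two_pi_mul_I (x : ℝ) :
    (starRingEnd ℂ) (Complex.exp (2 * Real.pi * Complex.I * x)) =
      Complex.exp (2 * Real.pi * Complex.I * (-x : ℝ)) := by
  rw [← Complex.exp_conj]
  congr 1
  simp [Complex.conj_ofNat]

theorem maskFn_add_intCast (B : Finset ℤ) (x : ℝ) (n : ℤ) : maskFn B (x + n) = maskFn B x := by
  unfold maskFn
  congr 1
  refine Finset.sum_congr rfl fun b _ => ?_
  rw [Complex.exp_eq_exp_iff_exists_int]
  exact ⟨b * n, by push_cast; ring⟩

/-- The inner products of the columns of the matrix of a Hadamard pair. -/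
theorem conjTranspose_mul_hadamardMatrix {R : ℕ} {B L : Finset ℤ} (hB : B.Nonempty) (l l' : L) :
    ((hadamardMatrix R B L).conjTranspose * hadamardMatrix R B L) l l' =
      maskFn B ((((l' : ℤ) - (l : ℤ) : ℤ) : ℝ) / R) := by
  have hN : (0 : ℝ) < B.card := by exact_mod_cast hB.card_pos
  rw [Matrix.mul_apply, maskFn, ← Finset.sum_coe_sort B, Finset.mul_sum]
  refine Finset.sum_congr rfl fun b _ => ?_
  have h1 := conj_exp_two_pi_mul_I ((b : ℤ) * (l : ℤ) / R)
  rw [Matrix.conjTranspose_apply, hadamardMatrix, hadamardMatrix, RCLike.star_def, map_mul,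
    map_inv₀, Complex.conj_ofReal]
  push_cast at h1 ⊢
  rw [show (2 * Real.pi * Complex.I * (b : ℤ) * (l : ℤ) / R : ℂ) =
    2 * Real.pi * Complex.I * ((b : ℤ) * (l : ℤ) / R) by ring, h1,
    mul_mul_mul_comm, ← Complex.exp_add, ← mul_inv, ← Complex.ofReal_mul,
    Real.mul_self_sqrt hN.le, Complex.ofReal_natCast]
  congr 2
  ring

/-- The inner products of the rows of the matrix of a Hadamard pair. -/
theorem hadamardMatrix_mul_conjTranspose {R : ℕ} {B L : Finset ℤ} (hB : B.Nonempty)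
    (hc : L.card = B.card) (b b' : B) :
    (hadamardMatrix R B L * (hadamardMatrix R B L).conjTranspose) b b' =
      maskFn L ((((b : ℤ) - (b' : ℤ) : ℤ) : ℝ) / R) := by
  have hN : (0 : ℝ) < B.card := by exact_mod_cast hB.card_pos
  rw [Matrix.mul_apply, maskFn, ← Finset.sum_coe_sort L, Finset.mul_sum]
  refine Finset.sum_congr rfl fun l _ => ?_
  have h1 := conj_exp_two_pi_mul_I ((b' : ℤ) * (l : ℤ) / R)
  rw [Matrix.conjTranspose_apply, hadamardMatrix, hadamardMatrix, RCLike.star_def, map_mul,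
    map_inv₀, Complex.conj_ofReal]
  push_cast at h1 ⊢
  rw [show (2 * Real.pi * Complex.I * (b' : ℤ) * (l : ℤ) / R : ℂ) =
    2 * Real.pi * Complex.I * ((b' : ℤ) * (l : ℤ) / R) by ring, h1,
    mul_mul_mul_comm, ← Complex.exp_add, ← mul_inv, ← Complex.ofReal_mul,
    Real.mul_self_sqrt hN.le, Complex.ofReal_natCast, hc]
  congr 2
  ring

theorem IsHadamardPair.nonempty {R : ℕ} {B L : Finset ℤ} (h : IsHadamardPair R B L) :
    B.Nonempty := ⟨0, h.zero_mem_left⟩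

theorem IsHadamardPair.maskFn_eq_zero {R : ℕ} {B L : Finset ℤ} (h : IsHadamardPair R B L) {l l' : ℤ}
    (hl : l ∈ L) (hl' : l' ∈ L) (hne : l ≠ l') : maskFn B (((l - l' : ℤ) : ℝ) / R) = 0 := by
  have := conjTranspose_mul_hadamardMatrix (R := R) h.nonempty ⟨l', hl'⟩ ⟨l, hl⟩
  rw [h.unitary_left, Matrix.one_apply_ne (by simpa using hne.symm)] at this
  exact this.symm

theorem IsHadamardPair.incongruent {R : ℕ} (hR : 2 ≤ R) {B L : Finset ℤ}
    (h : IsHadamardPair R B L) : Incongruent R (L : Set ℤ) := by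
  rintro l hl l' hl' ⟨q, hq⟩
  by_contra hne
  have := h.maskFn_eq_zero hl hl' hne
  have hR0 : (R : ℝ) ≠ 0 := by positivity
  rw [hq, Int.cast_mul, Int.cast_natCast, mul_div_cancel_left₀ _ hR0,
    maskFn_intCast h.nonempty] at this
  exact one_ne_zero this

/-- Expanding the square gives a double sum over B. The shift by `t` only contributes a unimodular
factor, so orthogonality of the rows kills the terms with b ≠ b'. -/
theorem IsHadamardPair.sum_norm_maskFn_sq {R : ℕ} {B L : Finset ℤ}
    (h : IsHadamardPair R B L) (t : ℝ) : ∑ l ∈ L, ‖maskFn B ((t + l) / R)‖ ^ 2 = 1 := by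
  have hN : (B.card : ℂ) ≠ 0 := by simpa using h.nonempty.ne_empty
  have key : ∀ b ∈ B, ∀ b' ∈ B, ∑ l ∈ L,
      Complex.exp (2 * Real.pi * Complex.I * (b : ℂ) * (((t + l) / R : ℝ) : ℂ)) *
        Complex.exp (2 * Real.pi * Complex.I * ((-(b' * ((t + l) / R)) : ℝ) : ℂ)) =
      if b = b' then (B.card : ℂ) else 0 := by
    intro b hb b' hb'
    have h1 := hadamardMatrix_mul_conjTranspose (R := R) h.nonempty h.card_eq ⟨b, hb⟩ ⟨b', hb'⟩
    rw [h.unitary_right, maskFn, h.card_eq, eq_inv_mul_iff_mul_eq₀ hN] at h1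
    have h2 : ∀ l ∈ L,
        Complex.exp (2 * Real.pi * Complex.I * (b : ℂ) * (((t + l) / R : ℝ) : ℂ)) *
          Complex.exp (2 * Real.pi * Complex.I * ((-(b' * ((t + l) / R)) : ℝ) : ℂ)) =
        Complex.exp (2 * Real.pi * Complex.I * ((b - b') * t / R)) *
          Complex.exp (2 * Real.pi * Complex.I * (l : ℂ) * ((((b - b' : ℤ) : ℝ) / R : ℝ) : ℂ)) := by
      intro l _
      rw [← Complex.exp_add, ← Complex.exp_add]
      congr 1
      push_cast
      ring
    rw [Finset.sum_congr rfl h2, ← Finset.mul_sum, ← h1, Matrix.one_apply]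
    simp only [Subtype.mk.injEq]
    split_ifs with e
    · simp [e]
    · simp
  have hsq : ∀ l : ℤ, ((‖maskFn B ((t + l) / R)‖ ^ 2 : ℝ) : ℂ) =
      ((B.card : ℂ)⁻¹ * (B.card : ℂ)⁻¹) * ∑ b ∈ B, ∑ b' ∈ B,
        Complex.exp (2 * Real.pi * Complex.I * (b : ℂ) * (((t + l) / R : ℝ) : ℂ)) *
        Complex.exp (2 * Real.pi * Complex.I * ((-(b' * ((t + l) / R)) : ℝ) : ℂ)) := by
    intro l
    rw [Complex.ofReal_pow, ← Complex.mul_conj', maskFn, map_mul, map_inv₀, map_natCast, map_sum,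
      mul_mul_mul_comm, Finset.sum_mul_sum]
    congr 1
    refine Finset.sum_congr rfl fun b _ => Finset.sum_congr rfl fun b' _ => ?_
    rw [← conj_exp_two_pi_mul_I]
    push_cast
    rw [mul_assoc (2 * Real.pi * Complex.I) (b' : ℂ)]
  have hfin : ((∑ l ∈ L, ‖maskFn B ((t + l) / R)‖ ^ 2 : ℝ) : ℂ) = 1 := by
    rw [Complex.ofReal_sum, Finset.sum_congr rfl fun l _ => hsq l, ← Finset.mul_sum,
      Finset.sum_comm]
    have : ∀ b ∈ B, ∑ l ∈ L, ∑ b' ∈ B,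
        Complex.exp (2 * Real.pi * Complex.I * (b : ℂ) * (((t + l) / R : ℝ) : ℂ)) *
        Complex.exp (2 * Real.pi * Complex.I * ((-(b' * ((t + l) / R)) : ℝ) : ℂ)) =
        (B.card : ℂ) := by
      intro b hb
      rw [Finset.sum_comm, Finset.sum_congr rfl fun b' hb' => key b hb b' hb']
      simp [hb]
    rw [Finset.sum_congr rfl this, Finset.sum_const, nsmul_eq_mul]
    field_simp
  exact_mod_cast hfin

/-! ### Complete residue sets -/

theorem IsCompleteResidueSet.bijOn {R : ℕ} [NeZero R] {S : Finset ℤ}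
    (h : IsCompleteResidueSet R (S : Set ℤ)) :
    Set.BijOn (fun s : ℤ => (s : ZMod R)) (S : Set ℤ) Set.univ := by
  refine ⟨fun _ _ => trivial, ?_, ?_⟩
  · intro s hs t ht e
    exact h.incongruent s hs t ht ((Int.modEq_iff_dvd).1
      ((ZMod.intCast_eq_intCast_iff t s R).1 (Eq.symm e)))
  · intro z _
    obtain ⟨s, ⟨hs, hsz⟩, -⟩ := h (z.val : ℤ)
    refine ⟨s, hs, ?_⟩
    have := (ZMod.intCast_eq_intCast_iff s z.val R).2 hsz
    simpa using this

theorem IsCompleteResidueSet.sum_eq {R : ℕ} [NeZero R] {S : Finset ℤ}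
    (h : IsCompleteResidueSet R (S : Set ℤ)) (f : ZMod R → ℂ) :
    ∑ s ∈ S, f (s : ZMod R) = ∑ z, f z :=
  Finset.sum_nbij (fun s : ℤ => (s : ZMod R)) (fun _ _ => Finset.mem_univ _) h.bijOn.injOn
    (by simpa using h.bijOn.surjOn) fun _ _ => rfl

theorem IsCompleteResidueSet.card_eq {R : ℕ} [NeZero R] {S : Finset ℤ}
    (h : IsCompleteResidueSet R (S : Set ℤ)) : S.card = R := by
  have := h.sum_eq fun _ => 1
  simp at this
  exact_mod_cast this

/-- `S` meets each residue class once, so this is orthogonality of additive characters of ℤ/R. -/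
theorem IsCompleteResidueSet.maskFn_eq_ite {R : ℕ} [NeZero R] {S : Finset ℤ}
    (h : IsCompleteResidueSet R (S : Set ℤ)) (k : ℤ) :
    maskFn S ((k : ℝ) / R) = if (k : ZMod R) = 0 then 1 else 0 := by
  classical
  have h1 := AddChar.sum_mulShift (k : ZMod R) (ZMod.isPrimitive_stdAddChar R)
  rw [← h.sum_eq] at h1
  rw [maskFn, h.card_eq]
  have h2 : ∀ s ∈ S, Complex.exp (2 * Real.pi * Complex.I * (s : ℂ) * (((k : ℝ) / R : ℝ) : ℂ)) =
      ZMod.stdAddChar ((s : ZMod R) * (k : ZMod R)) := by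
    intro s _
    rw [← Int.cast_mul, ZMod.stdAddChar_coe]
    congr 1
    push_cast
    ring
  rw [Finset.sum_congr rfl h2, h1]
  have : (R : ℂ) ≠ 0 := by exact_mod_cast NeZero.ne R
  split_ifs <;> simp [ZMod.card, this]

theorem isHadamardPair_of_isCompleteResidueSet {R : ℕ} [NeZero R] {A M : Finset ℤ}
    (hA : IsCompleteResidueSet R (A : Set ℤ)) (hM : IsCompleteResidueSet R (M : Set ℤ))
    (hA0 : (0 : ℤ) ∈ A) (hM0 : (0 : ℤ) ∈ M) : IsHadamardPair R A M := by
  have aux : ∀ {S : Finset ℤ}, IsCompleteResidueSet R (S : Set ℤ) → ∀ s t : S,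
      (((s : ℤ) - (t : ℤ) : ℤ) : ZMod R) = 0 ↔ s = t := by
    intro S hS s t
    rw [Int.cast_sub, sub_eq_zero]
    exact ⟨fun e => Subtype.ext (hS.bijOn.injOn s.2 t.2 e), fun e => by rw [e]⟩
  have hc : M.card = A.card := by rw [hA.card_eq, hM.card_eq]
  refine ⟨hA0, hM0, hc, ?_, ?_⟩
  · ext l l'
    rw [conjTranspose_mul_hadamardMatrix ⟨0, hA0⟩, hA.maskFn_eq_ite, Matrix.one_apply]
    simp only [aux hM, eq_comm]
  · ext b b'
    rw [hadamardMatrix_mul_conjTranspose ⟨0, hA0⟩ hc, hM.maskFn_eq_ite, Matrix.one_apply]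
    simp only [aux hA]

/-- Equality in the triangle inequality aligns all the unit vectors with the one at 0, which is 1.
The integers a with e^{2πiax} = 1 form a subgroup containing `A`, hence containing gcd 1. -/
theorem exists_eq_intCast_of_norm_maskFn_eq_one {A : Finset ℤ} (h0 : (0 : ℤ) ∈ A)
    (hg : A.gcd id = 1) {x : ℝ} (hx : ‖maskFn A x‖ = 1) : ∃ n : ℤ, x = n := by
  have hN : (0 : ℝ) < A.card := by exact_mod_cast Finset.card_pos.2 ⟨0, h0⟩
  set e : ℤ → ℂ := fun a => Complex.exp (2 * Real.pi * Complex.I * (a : ℂ) * (x : ℂ)) with he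
  have hnorm : ∀ a, ‖e a‖ = 1 := by
    intro a
    have := norm_exp_two_pi_mul_I (a * x)
    push_cast at this
    simp only [he]
    rw [mul_assoc, this]
  have he0 : e 0 = 1 := by simp [he]
  have hsum : ‖∑ a ∈ A, e a‖ = A.card := by
    rw [maskFn, norm_mul, norm_inv, Complex.norm_natCast, inv_mul_eq_iff_eq_mul₀ hN.ne'] at hx
    simpa using hx
  have hone : ∀ a ∈ A, e a = 1 := by
    intro a ha
    by_cases ha0 : a = 0
    · rw [ha0, he0]
    -- The other card A − 2 unit terms cannot contribute more than card A − 2 to a sum of norm card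
    -- A.
    have hlt : ‖e 0 + e a‖ ≥ 2 := by
      have h1 : ∑ a ∈ A, e a = (e 0 + e a) + ∑ b ∈ (A.erase 0).erase a, e b := by
        rw [← Finset.add_sum_erase A e h0,
          ← Finset.add_sum_erase (A.erase 0) e (Finset.mem_erase.2 ⟨ha0, ha⟩), add_assoc]
      have h2 : ‖∑ b ∈ (A.erase 0).erase a, e b‖ ≤ (A.card : ℝ) - 2 := by
        refine (norm_sum_le_of_le _ (n := fun _ => 1) fun b _ => (hnorm b).le).trans ?_
        rw [Finset.sum_const, nsmul_eq_mul, mul_one,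
          Finset.card_erase_of_mem (Finset.mem_erase.2 ⟨ha0, ha⟩), Finset.card_erase_of_mem h0]
        have : 1 < A.card := Finset.one_lt_card.2 ⟨0, h0, a, ha, Ne.symm ha0⟩
        rw [Nat.sub_sub, Nat.cast_sub (by omega)]
        norm_num
      have h3 := norm_add_le (e 0 + e a) (∑ b ∈ (A.erase 0).erase a, e b)
      rw [← h1, hsum] at h3
      linarith
    have h4 : ‖e 0 + e a‖ = ‖e 0‖ + ‖e a‖ :=
      le_antisymm (norm_add_le _ _) (by rw [hnorm, hnorm]; linarith)
    have h5 := (sameRay_iff_norm_add.2 h4).norm_smul_eq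
    rw [hnorm, hnorm, one_smul, one_smul, he0] at h5
    exact h5
  let I : AddSubgroup ℤ :=
    { carrier := {a | e a = 1}
      zero_mem' := he0
      add_mem' := fun {a b} (ha : e a = 1) (hb : e b = 1) => by
        change e (a + b) = 1
        have : e (a + b) = e a * e b := by
          simp only [he]
          rw [← Complex.exp_add]
          congr 1
          push_cast
          ring
        rw [this, ha, hb, one_mul]
      neg_mem' := fun {a} (ha : e a = 1) => by
        change e (-a) = 1
        have : e (-a) = (e a)⁻¹ := by
          simp only [he]
          rw [← Complex.exp_neg]
          congr 1
          push_cast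
          ring
        rw [this, ha, inv_one] }
  obtain ⟨g, hgI⟩ := Int.subgroup_cyclic I
  have hdvd : g ∣ A.gcd id := Finset.dvd_gcd fun a ha => by
    have : a ∈ I := hone a ha
    rw [hgI] at this
    exact Int.mem_zmultiples_iff.1 (by rwa [AddSubgroup.zmultiples_eq_closure])
  have h1I : (1 : ℤ) ∈ I := by
    rw [hgI, ← AddSubgroup.zmultiples_eq_closure]
    exact Int.mem_zmultiples_iff.2 (by rwa [hg] at hdvd)
  have h1 : e 1 = 1 := h1I
  simp only [he] at h1
  obtain ⟨n, hn⟩ := Complex.exp_eq_one_iff.1 h1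
  refine ⟨n, ?_⟩
  have h2 : (2 * Real.pi * Complex.I : ℂ) ≠ 0 := Complex.two_pi_I_ne_zero
  have h3 : (x : ℂ) = n := mul_left_cancel₀ h2 (by
    rw [Int.cast_one, mul_one] at hn
    rw [hn, mul_comm])
  exact_mod_cast h3

/-! ### Fourier transforms and exponentials in `L²` -/

/-- The Fourier transform `∫ e^{2πi t x} dμ(x)`. -/
def muHat (μ : Measure ℝ) (t : ℝ) : ℂ := ∫ x, expFn t x ∂μ

theorem expFn_eq (t x : ℝ) :
    expFn t x = Complex.exp (2 * Real.pi * Complex.I * ((t * x : ℝ) : ℂ)) := by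
  rw [expFn]
  push_cast
  ring_nf

theorem norm_expFn (t x : ℝ) : ‖expFn t x‖ = 1 := by
  rw [expFn_eq, norm_exp_two_pi_mul_I]

theorem conj_expFn (t x : ℝ) : (starRingEnd ℂ) (expFn t x) = expFn (-t) x := by
  rw [expFn_eq, conj_exp_two_pi_mul_I, expFn_eq]
  ring_nf

theorem expFn_add (s t x : ℝ) : expFn (s + t) x = expFn s x * expFn t x := by
  rw [expFn_eq, expFn_eq, expFn_eq, ← Complex.exp_add]
  congr 1
  push_cast
  ring

theorem expFn_zero (x : ℝ) : expFn 0 x = 1 := by simp [expFn]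

theorem continuous_expFn (t : ℝ) : Continuous (expFn t) := by
  unfold expFn
  fun_prop

theorem muHat_zero (μ : Measure ℝ) [IsProbabilityMeasure μ] : muHat μ 0 = 1 := by
  simp [muHat, expFn_zero]

theorem norm_muHat_neg (μ : Measure ℝ) (t : ℝ) : ‖muHat μ (-t)‖ = ‖muHat μ t‖ := by
  rw [muHat, muHat]
  simp_rw [← conj_expFn]
  rw [integral_conj, RCLike.norm_conj]

theorem coeFn_expLp (μ : Measure ℝ) [IsFiniteMeasure μ] (t : ℝ) : expLp μ t =ᵐ[μ] expFn t :=
  MemLp.coeFn_toLp _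

theorem inner_expLp (μ : Measure ℝ) [IsFiniteMeasure μ] (s t : ℝ) :
    inner ℂ (expLp μ s) (expLp μ t) = muHat μ (t - s) := by
  rw [L2.inner_def, muHat]
  refine integral_congr_ae ?_
  filter_upwards [coeFn_expLp μ s, coeFn_expLp μ t] with x hs ht
  rw [hs, ht, RCLike.inner_apply, conj_expFn, sub_eq_add_neg, expFn_add]

theorem norm_expLp (μ : Measure ℝ) [IsProbabilityMeasure μ] (t : ℝ) : ‖expLp μ t‖ = 1 := by
  rw [norm_eq_sqrt_re_inner (𝕜 := ℂ), inner_expLp, sub_self, muHat_zero]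
  simp

theorem muHat_eq_maskFn_mul {R : ℕ} {B : Finset ℤ} {μ : Measure ℝ} (h : IsInvariantMeasure R B μ)
    (t : ℝ) : muHat μ t = maskFn B (t / R) * muHat μ (t / R) := by
  have hc : ∀ s, muHat μ s = charFun μ (2 * Real.pi * s) := by
    intro s
    rw [charFun_apply_real, muHat]
    congr 1
    ext x
    rw [expFn]
    push_cast
    ring_nf
  rw [hc, charFun_of_isInvariantMeasure h, hc, maskFn, ← Finset.sum_mul,
    show 2 * Real.pi * t * (R : ℝ)⁻¹ = 2 * Real.pi * (t / R) by ring, mul_assoc (B.card : ℂ)⁻¹]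
  congr 2
  refine Finset.sum_congr rfl fun b _ => ?_
  congr 1
  push_cast
  ring

/-! ### Boundedness of the support of an invariant measure -/

/-- If |x| ≤ c + 2δ then |τ_b(x)| ≤ (2c + 2δ)/R ≤ c + δ. Invariance therefore bounds the mass beyond
c + δ by the mass beyond c + 2δ; doubling δ repeatedly drives that mass to 0. -/
theorem IsInvariantMeasure.measure_compl_Icc {R : ℕ} (hR : 2 ≤ R) {B : Finset ℤ} (hB : B.Nonempty)
    {μ : Measure ℝ} (h : IsInvariantMeasure R B μ) {c : ℝ} (hc : ∀ b ∈ B, |(b : ℝ)| ≤ c) {δ : ℝ}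
    (hδ : 0 < δ) : μ (Set.Icc (-(c + δ)) (c + δ))ᶜ = 0 := by
  have := h.1
  have hN : (B.card : ℝ≥0∞) ≠ 0 := by simpa using hB.ne_empty
  have hR' : (2 : ℝ) ≤ R := by exact_mod_cast hR
  have hc0 : 0 ≤ c := (abs_nonneg _).trans (hc _ hB.choose_spec)
  set S : ℝ → Set ℝ := fun δ => (Set.Icc (-(c + δ)) (c + δ))ᶜ with hS
  have hstep : ∀ δ : ℝ, 0 < δ → μ (S δ) ≤ μ (S (2 * δ)) := by
    intro δ hδ
    rw [h.2 _ measurableSet_Icc.compl]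
    calc (B.card : ℝ≥0∞)⁻¹ * ∑ b ∈ B, μ (tau R b ⁻¹' S δ)
        ≤ (B.card : ℝ≥0∞)⁻¹ * ∑ b ∈ B, μ (S (2 * δ)) := by
          gcongr with b hb
          intro x hx hx'
          refine hx ?_
          have h1 := abs_le.1 (hc b hb)
          rw [Set.mem_Icc, tau]
          have h2 : -(c + δ) * R ≤ x + b := by nlinarith [hx'.1]
          have h3 : x + b ≤ (c + δ) * R := by nlinarith [hx'.2]
          rw [inv_mul_eq_div]
          exact ⟨(le_div_iff₀ (by linarith)).2 h2, (div_le_iff₀ (by linarith)).2 h3⟩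
      _ = μ (S (2 * δ)) := by
          rw [Finset.sum_const, nsmul_eq_mul, ← mul_assoc,
            ENNReal.inv_mul_cancel hN (ENNReal.natCast_ne_top _), one_mul]
  have hiter : ∀ n : ℕ, μ (S δ) ≤ μ (S (2 ^ n * δ)) := by
    intro n
    induction n with
    | zero => simp
    | succ n ih =>
      refine ih.trans ((hstep _ (by positivity)).trans_eq ?_)
      rw [← mul_assoc, ← pow_succ']
  have hanti : Antitone fun n : ℕ => S (2 ^ n * δ) := by
    refine antitone_nat_of_succ_le fun n => Set.compl_subset_compl.2 (Set.Icc_subset_Icc ?_ ?_)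
    all_goals
      have : 0 < 2 ^ n * δ := by positivity
      rw [pow_succ]
      linarith
  have hlim := tendsto_measure_iInter_atTop (μ := μ)
    (fun n => (measurableSet_Icc.compl : MeasurableSet (S (2 ^ n * δ))).nullMeasurableSet)
    hanti ⟨0, measure_ne_top _ _⟩
  have hempty : ⋂ n : ℕ, S (2 ^ n * δ) = ∅ := by
    refine Set.eq_empty_of_forall_notMem fun x hx => ?_
    obtain ⟨n, hn⟩ := pow_unbounded_of_one_lt (|x| / δ) (one_lt_two : (1 : ℝ) < 2)
    rw [div_lt_iff₀ hδ] at hn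
    refine Set.mem_iInter.1 hx n ?_
    have := abs_le.1 hn.le
    exact ⟨by linarith, by linarith⟩
  rw [hempty, measure_empty] at hlim
  exact le_antisymm (ge_of_tendsto' hlim hiter) zero_le

theorem IsInvariantMeasure.exists_measure_compl_Icc {R : ℕ} (hR : 2 ≤ R) {B : Finset ℤ}
    (hB : B.Nonempty) {μ : Measure ℝ} (h : IsInvariantMeasure R B μ) :
    ∃ C : ℝ, 0 ≤ C ∧ μ (Set.Icc (-C) C)ᶜ = 0 := by
  refine ⟨∑ b ∈ B, |(b : ℝ)| + 1, by positivity, h.measure_compl_Icc hR hB (fun b hb => ?_) one_pos⟩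
  exact Finset.single_le_sum (f := fun b : ℤ => |(b : ℝ)|) (fun _ _ => abs_nonneg _) hb

/-! ### Measures with bounded support: analyticity and density of the exponentials -/

/-- Extension of a continuous function on `[a, b]` to a bounded function constant outside. -/
def extendIcc {a b : ℝ} (hab : a ≤ b) :
    C(Set.Icc a b, ℂ) →L[ℂ] BoundedContinuousFunction ℝ ℂ where
  toFun f := (BoundedContinuousFunction.mkOfCompact f).compContinuous
    ⟨Set.projIcc a b hab, continuous_projIcc⟩
  map_add' _ _ := rfl
  map_smul' _ _ := rfl
  cont := (BoundedContinuousFunction.continuous_compContinuous _).comp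
    (ContinuousMap.isometryEquivBoundedOfCompact _ _).continuous

/-- Extension of a continuous function on `[a, b]` to a bounded function constant outside, as an
element of `L²(μ)`. -/
def extendLp (μ : Measure ℝ) [IsFiniteMeasure μ] {a b : ℝ} (hab : a ≤ b) :
    C(Set.Icc a b, ℂ) →L[ℂ] Lp ℂ 2 μ :=
  (BoundedContinuousFunction.toLp 2 μ ℂ).comp (extendIcc hab)

theorem coeFn_extendLp (μ : Measure ℝ) [IsFiniteMeasure μ] {a b : ℝ} (hab : a ≤ b)
    (f : C(Set.Icc a b, ℂ)) : extendLp μ hab f =ᵐ[μ] fun x => f (Set.projIcc a b hab x) :=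
  BoundedContinuousFunction.coeFn_toLp 2 μ ℂ (extendIcc hab f)

/-- The exponential `e_t` on `[a, b]`. -/
def expIcc (a b t : ℝ) : C(Set.Icc a b, ℂ) :=
  ⟨fun x => expFn t x, (continuous_expFn t).comp continuous_subtype_val⟩

theorem extendLp_expIcc {μ : Measure ℝ} [IsFiniteMeasure μ] {a b : ℝ} (hab : a ≤ b)
    (hμ : μ (Set.Icc a b)ᶜ = 0) (t : ℝ) : extendLp μ hab (expIcc a b t) = expLp μ t := by
  refine Lp.ext ?_
  filter_upwards [coeFn_extendLp μ hab (expIcc a b t), coeFn_expLp μ t,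
    compl_mem_ae_iff.2 hμ] with x h1 h2 hx
  rw [compl_compl] at hx
  rw [h1, h2, Set.projIcc_of_mem hab hx]
  rfl

/-- On a bounded interval the multiplier 2πix is an element of the Banach algebra of continuous
functions, so t ↦ e_t is an exponential in that algebra. -/
theorem analyticAt_expIcc (a b t : ℝ) : AnalyticAt ℝ (expIcc a b) t := by
  let X : C(Set.Icc a b, ℂ) :=
    ⟨fun x => 2 * Real.pi * Complex.I * ((x : ℝ) : ℂ), by fun_prop⟩
  have h : expIcc a b = fun s : ℝ => NormedSpace.exp (s • X) := by
    ext s x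
    have h1 : (NormedSpace.exp (s • X)) x = NormedSpace.exp ((s • X) x) :=
      NormedSpace.map_exp (ContinuousMap.evalAlgHom ℂ ℂ x) (continuous_eval_const x) _
    rw [h1, ← Complex.exp_eq_exp_ℂ]
    change Complex.exp _ = Complex.exp (s • (2 * Real.pi * Complex.I * ((x : ℝ) : ℂ)))
    rw [Complex.real_smul]
    congr 1
    ring
  rw [h]
  exact (NormedSpace.exp_analytic (t • X)).comp_of_eq
    (analyticAt_id.smul analyticAt_const) rfl

theorem analyticAt_expLp {μ : Measure ℝ} [IsFiniteMeasure μ] {a b : ℝ} (hab : a ≤ b)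
    (hμ : μ (Set.Icc a b)ᶜ = 0) (t : ℝ) : AnalyticAt ℝ (expLp μ) t := by
  have : expLp μ = fun s => (extendLp μ hab).restrictScalars ℝ (expIcc a b s) :=
    funext fun s => (extendLp_expIcc hab hμ s).symm
  rw [this]
  exact ((ContinuousLinearMap.analyticAt _ _).comp (analyticAt_expIcc a b t))

/-- Stone–Weierstrass: the exponentials are closed under products and conjugation, so their span is
already a star subalgebra. -/
theorem span_expIcc_dense (a b : ℝ) :
    (Submodule.span ℂ (Set.range (expIcc a b))).topologicalClosure = ⊤ := by
  let A : StarSubalgebra ℂ C(Set.Icc a b, ℂ) :=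
    { toSubalgebra := Algebra.adjoin ℂ (Set.range (expIcc a b))
      star_mem' := by
        change Algebra.adjoin ℂ (Set.range (expIcc a b)) ≤
          star (Algebra.adjoin ℂ (Set.range (expIcc a b)))
        refine Algebra.adjoin_le ?_
        rintro - ⟨t, rfl⟩
        exact Algebra.subset_adjoin ⟨-t, ContinuousMap.ext fun x => (conj_expFn t x).symm⟩ }
  have hA : Subalgebra.toSubmodule A.toSubalgebra =
      Submodule.span ℂ (Set.range (expIcc a b)) := by
    refine Algebra.adjoin_eq_span_of_subset ℂ (Set.Subset.trans ?_ Submodule.subset_span)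
    intro f hf
    refine Submonoid.closure_induction (fun _ => id) ⟨0, ?_⟩ ?_ hf
    · exact ContinuousMap.ext fun x => expFn_zero x
    · rintro - - - - ⟨s, rfl⟩ ⟨t, rfl⟩
      exact ⟨s + t, ContinuousMap.ext fun x => expFn_add s t x⟩
  have hsep : A.SeparatesPoints := by
    intro x y hxy
    have hne : (x : ℝ) - y ≠ 0 := sub_ne_zero.2 fun h => hxy (Subtype.ext h)
    -- At this frequency the phases at x and y differ by π, so the two values are opposite and
    -- nonzero.
    refine ⟨_, ⟨expIcc a b (1 / (2 * (x - y))), Algebra.subset_adjoin ⟨_, rfl⟩, rfl⟩, ?_⟩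
    intro he
    have he' : expFn (1 / (2 * (x - y))) x = expFn (1 / (2 * (x - y))) y := he
    have h1 : expFn (1 / (2 * ((x : ℝ) - y))) x =
        expFn (1 / (2 * ((x : ℝ) - y))) y * Complex.exp (Real.pi * Complex.I) := by
      have hne' : (x : ℂ) - (y : ℂ) ≠ 0 := by exact_mod_cast hne
      rw [expFn, expFn, ← Complex.exp_add]
      congr 1
      push_cast
      field_simp
      ring
    rw [he', Complex.exp_pi_mul_I] at h1
    have h2 := norm_expFn (1 / (2 * ((x : ℝ) - y))) y
    have h3 : expFn (1 / (2 * ((x : ℝ) - y))) y = 0 := by linear_combination h1 / 2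
    rw [h3, norm_zero] at h2
    exact zero_ne_one h2
  rw [← hA]
  exact congr_arg (Subalgebra.toSubmodule <| StarSubalgebra.toSubalgebra ·)
    (ContinuousMap.starSubalgebra_topologicalClosure_eq_top_of_separatesPoints A hsep)

/-- Uniform density on [a, b] is carried to L² by extension. A bounded continuous function agrees
almost everywhere with the extension of its restriction, and such functions are dense in L². -/
theorem eq_top_of_forall_expLp_mem {μ : Measure ℝ} [IsFiniteMeasure μ] {a b : ℝ} (hab : a ≤ b)
    (hμ : μ (Set.Icc a b)ᶜ = 0) {V : Submodule ℂ (Lp ℂ 2 μ)} (hV : IsClosed (V : Set (Lp ℂ 2 μ)))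
    (h : ∀ t, expLp μ t ∈ V) : V = ⊤ := by
  have hle : (⊤ : Submodule ℂ C(Set.Icc a b, ℂ)) ≤ V.comap (extendLp μ hab).toLinearMap := by
    rw [← span_expIcc_dense a b]
    refine Submodule.topologicalClosure_minimal _ (Submodule.span_le.2 ?_)
      (hV.preimage (extendLp μ hab).continuous)
    rintro _ ⟨t, rfl⟩
    change extendLp μ hab (expIcc a b t) ∈ V
    rw [extendLp_expIcc hab hμ]
    exact h t
  have hrange : Set.range (BoundedContinuousFunction.toLp (α := ℝ) (E := ℂ) 2 μ ℂ) ⊆ V := by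
    rintro _ ⟨g, rfl⟩
    have : BoundedContinuousFunction.toLp 2 μ ℂ g =
        extendLp μ hab (g.toContinuousMap.restrict (Set.Icc a b)) := by
      refine Lp.ext ?_
      filter_upwards [coeFn_extendLp μ hab (g.toContinuousMap.restrict (Set.Icc a b)),
        BoundedContinuousFunction.coeFn_toLp 2 μ ℂ g, compl_mem_ae_iff.2 hμ] with x h1 h2 hx
      rw [compl_compl] at hx
      rw [h1, h2, Set.projIcc_of_mem hab hx]
      rfl
    rw [this]
    exact hle trivial
  have hd := BoundedContinuousFunction.toLp_denseRange (α := ℝ) ℂ μ ℂ (p := 2) ENNReal.ofNat_ne_top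
  refine Submodule.eq_top_iff'.2 fun f => ?_
  exact closure_minimal hrange hV (hd f)

/-! ### Extreme cycles in finite invariant sets -/

/-- A finite nonempty set of reals that is closed under all transitions `t ↦ (t + l) / R` of
nonzero weight contains an extreme cycle. -/
theorem exists_isExtremeCycle_of_finite {R : ℕ} (hR : 2 ≤ R) {B L : Finset ℤ}
    (h : IsHadamardPair R B L) {M : Finset ℝ} (hM : M.Nonempty)
    (hinv : ∀ t ∈ M, ∀ l ∈ L, maskFn B ((t + l) / R) ≠ 0 → (t + l) / R ∈ M) :
    ∃ (r : ℕ) (_ : NeZero r) (x : Fin r → ℝ) (l : Fin r → ℤ),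
      IsExtremeCycle R B L x l ∧ ∀ k, x k ∈ M := by
  classical
  have hR0 : (R : ℝ) ≠ 0 := by positivity
  -- Sets of points distinct modulo ℤ. Two transitions with images congruent modulo ℤ start at
  -- points congruent modulo ℤ and have digits congruent modulo R, so they coincide. Hence `next`
  -- preserves goodness and does not decrease cardinality.
  let good : Finset ℝ → Prop := fun E =>
    E ⊆ M ∧ E.Nonempty ∧ ∀ s ∈ E, ∀ t ∈ E, (∃ n : ℤ, s - t = n) → s = t
  let allowed : ℝ → Finset ℤ := fun t => L.filter fun l => maskFn B ((t + l) / R) ≠ 0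
  let next : Finset ℝ → Finset ℝ := fun E =>
    E.biUnion fun t => (allowed t).image fun l : ℤ => (t + l) / R
  have hsum : ∀ t, ∑ l ∈ allowed t, ‖maskFn B ((t + l) / R)‖ ^ 2 = 1 := by
    intro t
    rw [← h.sum_norm_maskFn_sq t]
    refine Finset.sum_filter_of_ne fun l _ hl he => hl ?_
    rw [he]
    simp
  have hallowed : ∀ t, 1 ≤ (allowed t).card := by
    intro t
    refine Finset.card_pos.2 (Finset.nonempty_iff_ne_empty.2 fun he => ?_)
    have := hsum t
    rw [he, Finset.sum_empty] at this
    exact zero_ne_one this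
  have hkey : ∀ E, good E → ∀ s ∈ E, ∀ t ∈ E, ∀ l ∈ L, ∀ l' ∈ L,
      (∃ n : ℤ, (s + l) / R - (t + l') / R = n) → s = t ∧ l = l' := by
    rintro E ⟨-, -, hE⟩ s hs t ht l hl l' hl' ⟨n, hn⟩
    have e : s - t = R * n + l' - l := by
      field_simp at hn
      linarith
    have hst : s = t := hE s hs t ht ⟨R * n + l' - l, by rw [e]; push_cast; ring⟩
    refine ⟨hst, h.incongruent hR l hl l' hl' ⟨n, ?_⟩⟩
    rw [hst, sub_self] at e
    have : (l : ℝ) - l' = R * n := by linarith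
    exact_mod_cast this
  have hnext : ∀ E, good E → good (next E) := by
    intro E hE
    refine ⟨?_, ?_, ?_⟩
    · intro y hy
      simp only [next, allowed, Finset.mem_biUnion, Finset.mem_image, Finset.mem_filter] at hy
      obtain ⟨t, ht, l, ⟨hl, hm⟩, rfl⟩ := hy
      exact hinv t (hE.1 ht) l hl hm
    · obtain ⟨t, ht⟩ := hE.2.1
      obtain ⟨l, hl⟩ := Finset.card_pos.1 (hallowed t)
      exact ⟨_, Finset.mem_biUnion.2 ⟨t, ht, Finset.mem_image_of_mem _ hl⟩⟩
    · intro y hy z hz hn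
      simp only [next, allowed, Finset.mem_biUnion, Finset.mem_image, Finset.mem_filter] at hy hz
      obtain ⟨s, hs, l, ⟨hl, -⟩, rfl⟩ := hy
      obtain ⟨t, ht, l', ⟨hl', -⟩, rfl⟩ := hz
      obtain ⟨rfl, rfl⟩ := hkey E hE s hs t ht l hl l' hl' hn
      rfl
  have hcard : ∀ E, good E → (next E).card = ∑ t ∈ E, (allowed t).card := by
    intro E hE
    rw [Finset.card_biUnion]
    · refine Finset.sum_congr rfl fun t ht => Finset.card_image_of_injOn ?_
      intro l hl l' hl' e
      exact (hkey E hE t ht t ht l (Finset.mem_filter.1 hl).1 l' (Finset.mem_filter.1 hl').1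
        ⟨0, by simpa [sub_eq_zero] using e⟩).2
    · intro s hs t ht hst
      refine Finset.disjoint_left.2 fun y hy hz => hst ?_
      obtain ⟨l, hl, rfl⟩ := Finset.mem_image.1 hy
      obtain ⟨l', hl', e⟩ := Finset.mem_image.1 hz
      exact (hkey E hE s hs t ht l (Finset.mem_filter.1 hl).1 l' (Finset.mem_filter.1 hl').1
        ⟨0, by simpa [sub_eq_zero] using e.symm⟩).1
  obtain ⟨t₀, ht₀⟩ := hM
  have hgood₀ : good {t₀} := by
    refine ⟨by simpa using ht₀, Finset.singleton_nonempty _, fun s hs t ht _ => ?_⟩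
    rw [Finset.mem_singleton] at hs ht
    rw [hs, ht]
  obtain ⟨E₀, hE₀, hmax⟩ := Finset.exists_max_image (M.powerset.filter good) Finset.card
    ⟨{t₀}, Finset.mem_filter.2 ⟨Finset.mem_powerset.2 hgood₀.1, hgood₀⟩⟩
  have hmax' : ∀ E, good E → E.card ≤ E₀.card := fun E hE =>
    hmax E (Finset.mem_filter.2 ⟨Finset.mem_powerset.2 hE.1, hE⟩)
  -- The union of the good sets of maximal cardinality. On such a set no branching is possible: each
  -- point has a single allowed transition, whose weight is therefore 1.
  let G : Finset ℝ := M.filter fun t => ∃ E, good E ∧ E.card = E₀.card ∧ t ∈ E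
  have hstep : ∀ t : G, ∃ y : G, ∃ l ∈ L, ((t : ℝ) + l) / R = y ∧ ‖maskFn B (y : ℝ)‖ = 1 := by
    rintro ⟨t, ht⟩
    obtain ⟨htM, E, hE, hEc, htE⟩ := Finset.mem_filter.1 ht
    have hle : ∀ s ∈ E, 1 ≤ (allowed s).card := fun s _ => hallowed s
    have hge : E.card ≤ ∑ s ∈ E, (allowed s).card := by
      simpa using Finset.sum_le_sum hle
    have hnc : (next E).card = E.card :=
      le_antisymm ((hmax' _ (hnext E hE)).trans hEc.ge) (hge.trans (hcard E hE).ge)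
    have hone : (allowed t).card = 1 := by
      have h1 : ∑ s ∈ E, 1 = ∑ s ∈ E, (allowed s).card := by
        rw [← hcard E hE, hnc]
        simp
      exact ((Finset.sum_eq_sum_iff_of_le hle).1 h1 t htE).symm
    obtain ⟨l, hl⟩ := Finset.card_eq_one.1 hone
    have hlmem : l ∈ allowed t := by simp [hl]
    have hlL := (Finset.mem_filter.1 hlmem).1
    have hmem : (t + l) / R ∈ next E :=
      Finset.mem_biUnion.2 ⟨t, htE, Finset.mem_image_of_mem _ hlmem⟩
    refine ⟨⟨(t + l) / R, Finset.mem_filter.2 ⟨(hnext E hE).1 hmem, next E, hnext E hE,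
      hnc.trans hEc, hmem⟩⟩, l, hlL, rfl, ?_⟩
    have h2 := hsum t
    rw [hl, Finset.sum_singleton] at h2
    exact (pow_eq_one_iff_of_nonneg (norm_nonneg _) two_ne_zero).1 h2
  choose g d hd hg hn using hstep
  have hne : ∃ t, t ∈ E₀ := (Finset.mem_filter.1 hE₀).2.2.1
  obtain ⟨t, ht⟩ := hne
  have htG : t ∈ G := Finset.mem_filter.2
    ⟨(Finset.mem_filter.1 hE₀).2.1 ht, E₀, (Finset.mem_filter.1 hE₀).2, rfl, ht⟩
  obtain ⟨i, r, hr, hper⟩ : ∃ i r : ℕ, r ≠ 0 ∧ g^[i + r] ⟨t, htG⟩ = g^[i] ⟨t, htG⟩ := by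
    obtain ⟨i, j, hij, e⟩ := Finite.exists_ne_map_eq_of_infinite fun k : ℕ => g^[k] ⟨t, htG⟩
    rcases lt_or_gt_of_ne hij with hlt | hlt
    · exact ⟨i, j - i, by omega, by rw [e]; congr 2; omega⟩
    · exact ⟨j, i - j, by omega, by rw [← e]; congr 2; omega⟩
  have : NeZero r := ⟨hr⟩
  -- The extra step makes every point, including the first, a value of `g`, where the mask is known
  -- to have modulus 1.
  let x : ℕ → ℝ := fun k => g^[i + k + 1] ⟨t, htG⟩
  have hx : ∀ k, (x k + d (g^[i + k + 1] ⟨t, htG⟩)) / R = x (k + 1) := by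
    intro k
    simp only [x]
    rw [hg, ← Function.iterate_succ_apply' g]
    rfl
  refine ⟨r, this, fun k => x k, fun k => d (g^[i + k + 1] ⟨t, htG⟩), ⟨?_, fun k => ?_⟩, fun k => ?_⟩
  · refine isCycle_of_periodic (d := fun k => d (g^[i + k + 1] ⟨t, htG⟩))
      (fun k => ⟨hd _, hx k⟩) ?_
    simp only [x]
    rw [Function.iterate_succ_apply' g, hper, ← Function.iterate_succ_apply' g]
  · simp only [x]
    rw [Function.iterate_succ_apply' g]
    exact hn _
  · exact (Finset.mem_filter.1 (g^[i + k + 1] ⟨t, htG⟩).2).1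

/-! ### Projection onto the closed span of an orthonormal family -/

/-- The family is a Hilbert basis of its closed span, so this is Parseval for the projected vector.
-/
theorem hasSum_norm_inner_sq {ι E : Type*} [NormedAddCommGroup E] [InnerProductSpace ℂ E]
    [CompleteSpace E] {v : ι → E} (hv : Orthonormal ℂ v) (U : Submodule ℂ E) [CompleteSpace U]
    (hU : U = (Submodule.span ℂ (Set.range v)).topologicalClosure) (x : E) :
    HasSum (fun i => ‖inner ℂ (v i) x‖ ^ 2) (‖U.starProjection x‖ ^ 2) := by
  have hmem : ∀ i, v i ∈ U := fun i => by
    rw [hU]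
    exact Submodule.le_topologicalClosure _ (Submodule.subset_span ⟨i, rfl⟩)
  let w : ι → U := fun i => ⟨v i, hmem i⟩
  have hw : Orthonormal ℂ w := by
    classical
    rw [orthonormal_iff_ite] at hv ⊢
    exact hv
  have hbot : (Submodule.span ℂ (Set.range w))ᗮ = ⊥ := by
    rw [eq_bot_iff]
    intro u hu
    have h1 : Submodule.span ℂ (Set.range v) ≤ (ℂ ∙ (u : E))ᗮ := by
      refine Submodule.span_le.2 ?_
      rintro _ ⟨i, rfl⟩
      refine Submodule.mem_orthogonal_singleton_iff_inner_left.2 ?_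
      exact (Submodule.mem_orthogonal _ _).1 hu (w i) (Submodule.subset_span ⟨i, rfl⟩)
    have h2 : U ≤ (ℂ ∙ (u : E))ᗮ := by
      exact hU.le.trans
        (Submodule.topologicalClosure_minimal _ h1 (Submodule.isClosed_orthogonal _))
    have h3 := Submodule.mem_orthogonal_singleton_iff_inner_left.1 (h2 u.2)
    exact Subtype.ext (inner_self_eq_zero.1 h3)
  let b := HilbertBasis.mkOfOrthogonalEqBot hw hbot
  have hb : ∀ i, b i = w i := fun i => by
    rw [show (b : ι → U) = w from HilbertBasis.coe_mkOfOrthogonalEqBot hw hbot]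
  have hs := b.hasSum_inner_mul_inner (U.orthogonalProjectionOnto x)
    (U.orthogonalProjectionOnto x)
  have he : ∀ i, inner ℂ (U.orthogonalProjectionOnto x) (b i) *
      inner ℂ (b i) (U.orthogonalProjectionOnto x) = ((‖inner ℂ (v i) x‖ ^ 2 : ℝ) : ℂ) := by
    intro i
    rw [← inner_conj_symm, Complex.conj_mul', hb,
      Submodule.inner_orthogonalProjectionOnto_eq_of_mem_left]
    push_cast
    rfl
  simp only [he] at hs
  rw [inner_self_eq_norm_sq_to_K] at hs
  rw [Submodule.starProjection_apply, ← Submodule.coe_norm]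
  exact Complex.hasSum_ofReal.1 (by simpa using hs)

/-! ### The spectrum of an invariant measure -/

/-- The closed span of the exponentials with frequencies in `Λ`. -/
def expSpan (μ : Measure ℝ) [IsFiniteMeasure μ] (Λ : Set ℤ) : Submodule ℂ (Lp ℂ 2 μ) :=
  (Submodule.span ℂ (expLp μ '' ((fun n : ℤ => (n : ℝ)) '' Λ))).topologicalClosure

theorem isClosed_expSpan (μ : Measure ℝ) [IsFiniteMeasure μ] (Λ : Set ℤ) :
    IsClosed (expSpan μ Λ : Set (Lp ℂ 2 μ)) := Submodule.isClosed_topologicalClosure _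

instance (μ : Measure ℝ) [IsFiniteMeasure μ] (Λ : Set ℤ) : CompleteSpace (expSpan μ Λ) :=
  (isClosed_expSpan μ Λ).completeSpace_coe

/-- The squared norm of the projection of `e_{-t}` to the closed span of `{e_λ : λ ∈ Λ}`. -/
def spectralSum (μ : Measure ℝ) [IsFiniteMeasure μ] (Λ : Set ℤ) (t : ℝ) : ℝ :=
  ‖(expSpan μ Λ).starProjection (expLp μ (-t))‖ ^ 2

theorem hasSum_spectralSum {μ : Measure ℝ} [IsProbabilityMeasure μ] {Λ : Set ℤ}
    (h : ∀ s ∈ Λ, ∀ t ∈ Λ, s ≠ t → muHat μ ((t : ℝ) - s) = 0) (t : ℝ) :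
    HasSum (fun s : Λ => ‖muHat μ (t + (s : ℤ))‖ ^ 2) (spectralSum μ Λ t) := by
  have hv : Orthonormal ℂ fun s : Λ => expLp μ (s : ℤ) :=
    ⟨fun s => norm_expLp μ _, fun s t hst => by
      simp only
      rw [inner_expLp]
      exact h s s.2 t t.2 fun e => hst (Subtype.ext e)⟩
  have := hasSum_norm_inner_sq hv (expSpan μ Λ) (by
    rw [expSpan, Set.image_image, Set.image_eq_range]) (expLp μ (-t))
  simp only [inner_expLp] at this
  rw [spectralSum]
  convert this using 3 with s
  rw [← norm_muHat_neg]
  congr 2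
  ring

/-- A projection that does not shorten a vector fixes it. -/
theorem expLp_mem_expSpan {μ : Measure ℝ} [IsProbabilityMeasure μ] {Λ : Set ℤ} {t : ℝ}
    (h : 1 ≤ spectralSum μ Λ t) : expLp μ (-t) ∈ expSpan μ Λ := by
  rw [Submodule.mem_iff_norm_starProjection, norm_expLp]
  have h1 := Submodule.norm_starProjection_apply_le (expSpan μ Λ) (expLp μ (-t))
  rw [norm_expLp] at h1
  refine le_antisymm h1 ?_
  rw [spectralSum] at h
  exact (one_le_sq_iff₀ (norm_nonneg _)).1 h

theorem analyticAt_spectralSum {μ : Measure ℝ} [IsFiniteMeasure μ] {a b : ℝ} (hab : a ≤ b)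
    (hμ : μ (Set.Icc a b)ᶜ = 0) (Λ : Set ℤ) (t : ℝ) : AnalyticAt ℝ (spectralSum μ Λ) t := by
  -- The complex inner product is only sesquilinear; over ℝ the squared norm comes from a continuous
  -- bilinear form, which preserves analyticity.
  let _ : InnerProductSpace ℝ (Lp ℂ 2 μ) := InnerProductSpace.rclikeToReal ℂ _
  let P : ℝ → Lp ℂ 2 μ := fun t => (expSpan μ Λ).starProjection (expLp μ (-t))
  have hP : AnalyticAt ℝ P t := by
    have h1 : AnalyticAt ℝ (fun t => expLp μ (-t)) t :=
      (analyticAt_expLp hab hμ (-t)).comp_of_eq analyticAt_id.neg rfl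
    exact (((expSpan μ Λ).starProjection.restrictScalars ℝ).analyticAt _).comp h1
  have h2 : spectralSum μ Λ = fun t => innerSL ℝ (P t) (P t) := by
    ext t
    rw [innerSL_apply_apply, real_inner_self_eq_norm_sq]
    rfl
  rw [h2]
  exact ((innerSL ℝ).analyticAt_bilinear (P t, P t)).comp₂ hP hP

/-- In the refinement equation the mask sees only the difference of the leading digits and vanishes
if they differ. A nonzero value thus forces equal digits and passes to the quotients, so all digits
agree and s = t. -/
theorem IsHadamardPair.muHat_eq_zero {R : ℕ} (hR : 2 ≤ R) {B L : Finset ℤ}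
    (h : IsHadamardPair R B L) {μ : Measure ℝ} (hμ : IsInvariantMeasure R B μ) {s t : ℤ}
    (hs : s ∈ representable R L) (ht : t ∈ representable R L) (hne : s ≠ t) :
    muHat μ ((t : ℝ) - s) = 0 := by
  have hR0 : (R : ℝ) ≠ 0 := by positivity
  obtain ⟨n, d, hn, rfl⟩ := mem_representable_iff.1 hs
  obtain ⟨m, c, hm, rfl⟩ := mem_representable_iff.1 ht
  by_contra hz
  have hstep : ∀ k, muHat μ ((m k : ℝ) - n k) ≠ 0 →
      d k = c k ∧ muHat μ ((m (k + 1) : ℝ) - n (k + 1)) ≠ 0 := by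
    intro k hk
    rw [muHat_eq_maskFn_mul hμ] at hk
    have e : ((m k : ℝ) - n k) / R =
        ((c k - d k : ℤ) : ℝ) / R + ((m (k + 1) - n (k + 1) : ℤ) : ℝ) := by
      rw [(hn k).2, (hm k).2]
      push_cast
      field_simp
      ring
    have hdc : d k = c k := by
      by_contra hne
      refine left_ne_zero_of_mul hk ?_
      rw [e, maskFn_add_intCast]
      exact h.maskFn_eq_zero (hm k).1 (hn k).1 (Ne.symm hne)
    refine ⟨hdc, ?_⟩
    have h2 := right_ne_zero_of_mul hk
    rw [e, hdc] at h2
    simpa using h2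
  have hall : ∀ k, muHat μ ((m k : ℝ) - n k) ≠ 0 := by
    intro k
    induction k with
    | zero => exact hz
    | succ k ih => exact (hstep k ih).2
  have hdc : d = c := funext fun k => (hstep k (hall k)).1
  subst hdc
  exact hne (hn.eq_of_digits_eq hR hm)

/-- Λ is the disjoint union of the sets RΛ + l. On each piece the refinement equation pulls out a
mask factor, which is independent of the element of Λ by periodicity. -/
theorem IsHadamardPair.spectralSum_eq {R : ℕ} (hR : 2 ≤ R) {B L : Finset ℤ}
    (h : IsHadamardPair R B L) {μ : Measure ℝ} [IsProbabilityMeasure μ]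
    (hμ : IsInvariantMeasure R B μ) (t : ℝ) :
    spectralSum μ (representable R L) t = ∑ l ∈ L,
      ‖maskFn B ((t + l) / R)‖ ^ 2 * spectralSum μ (representable R L) ((t + l) / R) := by
  have hR0 : (R : ℝ) ≠ 0 := by positivity
  have hR0' : (R : ℤ) ≠ 0 := by positivity
  have horth : ∀ s ∈ representable R L, ∀ t ∈ representable R L, s ≠ t →
      muHat μ ((t : ℝ) - s) = 0 := fun s hs t ht => h.muHat_eq_zero hR hμ hs ht
  let e : L × representable R L → representable R L := fun q =>
    ⟨(R : ℤ) * (q.2 : ℤ) + q.1, mul_add_mem_representable q.2.2 q.1.2⟩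
  have he : Function.Bijective e := by
    constructor
    · rintro ⟨l, x⟩ ⟨l', x'⟩ hq
      have hq' : (R : ℤ) * (x : ℤ) + l = (R : ℤ) * (x' : ℤ) + l' := congrArg Subtype.val hq
      have hl : (l : ℤ) = l' :=
        h.incongruent hR l l.2 l' l'.2 ⟨(x' : ℤ) - x, by linarith⟩
      have hx : (x : ℤ) = x' := mul_left_cancel₀ hR0' (by linarith)
      exact Prod.ext (Subtype.ext hl) (Subtype.ext hx)
    · rintro ⟨x, hx⟩
      obtain ⟨l, hl, y, hy, rfl⟩ := exists_of_mem_representable hx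
      exact ⟨(⟨l, hl⟩, ⟨y, hy⟩), rfl⟩
  have h1 := (Equiv.ofBijective e he).hasSum_iff.2 (hasSum_spectralSum horth t)
  have h2 := h1.prod_fiberwise (g := fun l : L => ‖maskFn B ((t + (l : ℤ)) / R)‖ ^ 2 *
      spectralSum μ (representable R L) ((t + (l : ℤ)) / R)) fun l => by
    have hx : ∀ x : representable R L, ‖muHat μ (t + (e (l, x) : ℤ))‖ ^ 2 =
        ‖maskFn B ((t + (l : ℤ)) / R)‖ ^ 2 * ‖muHat μ ((t + (l : ℤ)) / R + (x : ℤ))‖ ^ 2 := by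
      intro x
      have e1 : (t + ((R : ℤ) * (x : ℤ) + (l : ℤ) : ℤ)) / R = (t + (l : ℤ)) / R + (x : ℤ) := by
        push_cast
        field_simp
        ring
      simp only [e]
      rw [muHat_eq_maskFn_mul hμ, e1, maskFn_add_intCast, norm_mul, mul_pow]
    have h3 := (hasSum_spectralSum horth ((t + (l : ℤ)) / R)).mul_left
      (‖maskFn B ((t + (l : ℤ)) / R)‖ ^ 2)
    simp only [← hx] at h3
    exact h3
  rw [← Finset.sum_coe_sort L]
  exact h2.unique (hasSum_fintype _)

/-- A minimum principle for the averaging equation of `IsHadamardPair.spectralSum_eq`, combined with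
the identity theorem for analytic functions. -/
theorem IsHadamardPair.one_le_spectralSum {R : ℕ} (hR : 2 ≤ R) {B L : Finset ℤ}
    (h : IsHadamardPair R B L) {μ : Measure ℝ} [IsProbabilityMeasure μ]
    (hμ : IsInvariantMeasure R B μ)
    (hi : ∀ (r : ℕ) [NeZero r] (x : Fin r → ℝ) (l : Fin r → ℤ),
      IsExtremeCycle R B L x l → ∀ k, ∃ n : ℤ, x k = n) (t : ℝ) :
    1 ≤ spectralSum μ (representable R L) t := by
  have hR0 : (R : ℝ) ≠ 0 := by positivity
  have hR' : (2 : ℝ) ≤ R := by exact_mod_cast hR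
  have horth : ∀ s ∈ representable R L, ∀ t ∈ representable R L, s ≠ t →
      muHat μ ((t : ℝ) - s) = 0 := fun s hs t ht => h.muHat_eq_zero hR hμ hs ht
  set H := spectralSum μ (representable R L) with hH
  -- The frequency −n contributes the term |μ̂(0)|² = 1.
  have hlow : ∀ n : ℤ, -n ∈ representable R L → 1 ≤ H n := by
    intro n hn
    refine le_trans ?_ (le_hasSum (hasSum_spectralSum horth n) ⟨-n, hn⟩ fun _ _ => by positivity)
    simp [muHat_zero]
  obtain ⟨C₀, hC₀, hsupp⟩ := hμ.exists_measure_compl_Icc hR h.nonempty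
  have hana : AnalyticOnNhd ℝ H Set.univ := fun s _ =>
    analyticAt_spectralSum (by linarith) hsupp _ s
  -- Large enough for the interval to contain `t`, and for |s + l| ≤ 2C ≤ RC whenever |s| ≤ C, so
  -- that the transitions preserve it.
  set C : ℝ := |t| + ∑ l ∈ L, |(l : ℝ)| with hC
  have hLC : ∀ l ∈ L, |(l : ℝ)| ≤ C := fun l hl => by
    have := Finset.single_le_sum (f := fun l : ℤ => |(l : ℝ)|) (fun _ _ => abs_nonneg _) hl
    have := abs_nonneg t
    linarith
  have hC0 : 0 ≤ C := by positivity
  have htC : t ∈ Set.Icc (-C) C := abs_le.1 (by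
    have : 0 ≤ ∑ l ∈ L, |(l : ℝ)| := by positivity
    linarith)
  have hmaps : ∀ s ∈ Set.Icc (-C) C, ∀ l ∈ L, (s + l) / R ∈ Set.Icc (-C) C := by
    intro s hs l hl
    have := abs_le.1 (hLC l hl)
    have hRp : (0 : ℝ) < R := by linarith
    exact ⟨(le_div_iff₀ hRp).2 (by nlinarith [hs.1]), (div_le_iff₀ hRp).2 (by nlinarith [hs.2])⟩
  obtain ⟨s, hs, hmin⟩ := isCompact_Icc.exists_isMinOn ⟨t, htC⟩
    (hana.continuousOn.mono (Set.subset_univ (Set.Icc (-C) C)))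
  refine le_trans ?_ (hmin htC)
  set M : Set ℝ := {y ∈ Set.Icc (-C) C | H y = H s} with hM
  have hinv : ∀ y ∈ M, ∀ l ∈ L, maskFn B ((y + l) / R) ≠ 0 → (y + l) / R ∈ M := by
    rintro y ⟨hy, hyH⟩ l hl hne
    refine ⟨hmaps y hy l hl, ?_⟩
    have h1 := h.spectralSum_eq hR hμ y
    rw [← hH, hyH] at h1
    have h2 : ∑ l ∈ L, ‖maskFn B ((y + l) / R)‖ ^ 2 * H s = H s := by
      rw [← Finset.sum_mul, h.sum_norm_maskFn_sq, one_mul]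
    -- A weighted average of values that are at least the minimum equals the minimum, so each value
    -- with nonzero weight is minimal.
    have h3 := (Finset.sum_eq_sum_iff_of_le fun l hl => mul_le_mul_of_nonneg_left
      (hmin (hmaps y hy l hl)) (sq_nonneg ‖maskFn B ((y + l) / R)‖)).1 (h2.trans h1) l hl
    exact (mul_left_cancel₀ (by simpa using hne) h3).symm
  by_cases hfin : M.Finite
  · obtain ⟨r, _, x, d, hx, hxM⟩ := exists_isExtremeCycle_of_finite hR h
      (M := hfin.toFinset) ⟨s, by simpa [hM] using hs⟩ (by simpa using hinv)
    have hint := hi r x d hx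
    obtain ⟨n, hn, hexp⟩ := hx.1.exists_isExpansion hR hint
    have h0 := hn 0
    have hmem : x (Fin.ofNat r 0) ∈ M := by simpa using hxM (Fin.ofNat r 0)
    rw [← hmem.2, h0, ← Int.cast_neg]
    exact hlow _ (by simpa using hexp.mem_representable 0)
  -- Infinitely many minimum points accumulate, so the analytic function is constant and can be
  -- evaluated at 0 ∈ Λ.
  · obtain ⟨z, -, hz⟩ := Set.Infinite.exists_accPt_of_subset_isCompact hfin
      (isCompact_Icc (a := -C) (b := C)) fun y hy => hy.1
    have hfreq : ∃ᶠ y in nhdsWithin z {z}ᶜ, H y = H s := by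
      rw [accPt_iff_frequently_nhdsNE] at hz
      exact hz.mono fun y hy => hy.2
    have := hana.eqOn_of_preconnected_of_frequently_eq (analyticOnNhd_const (v := H s))
      isPreconnected_univ (Set.mem_univ z) hfreq (Set.mem_univ 0)
    simp only at this
    rw [← this]
    simpa using hlow 0 (by simpa using zero_mem_representable h.zero_mem_right)

/-- If all extreme cycles of the Hadamard pair `(B, L)` consist of integers, then the integers
representable with digits in `L` are a spectrum of the invariant measure. -/
theorem IsHadamardPair.isSpectrum {R : ℕ} (hR : 2 ≤ R) {B L : Finset ℤ}
    (h : IsHadamardPair R B L)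
    (hi : ∀ (r : ℕ) [NeZero r] (x : Fin r → ℝ) (l : Fin r → ℤ),
      IsExtremeCycle R B L x l → ∀ k, ∃ n : ℤ, x k = n) :
    IsSpectrum (invariantMeasure R B) ((fun n : ℤ => (n : ℝ)) '' representable R L) := by
  have hμ := isInvariantMeasure_invariantMeasure hR h.nonempty
  have := hμ.1
  obtain ⟨C, hC, hsupp⟩ := hμ.exists_measure_compl_Icc hR h.nonempty
  refine ⟨?_, ?_⟩
  · rintro _ ⟨s, hs, rfl⟩ _ ⟨t, ht, rfl⟩ hst
    rw [inner_expLp]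
    exact h.muHat_eq_zero hR hμ hs ht fun e => hst (by rw [e])
  · refine eq_top_of_forall_expLp_mem (by linarith) hsupp (isClosed_expSpan _ _) fun t => ?_
    rw [← neg_neg t]
    exact expLp_mem_expSpan (h.one_le_spectralSum hR hμ hi (-t))

/-! ### Convolution of invariant measures -/

theorem IsInvariantMeasure.eq_smul_sum_map {R : ℕ} {B : Finset ℤ} {μ : Measure ℝ}
    (h : IsInvariantMeasure R B μ) : μ = (B.card : ℝ≥0∞)⁻¹ • ∑ b ∈ B, μ.map (tau R b) := by
  ext E hE
  rw [h.2 E hE, Measure.smul_apply, Measure.finsetSum_apply, smul_eq_mul]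
  congr 1
  exact Finset.sum_congr rfl fun b _ => by rw [Measure.map_apply (measurable_tau R b) hE]

theorem IsInvariantMeasure.lintegral_eq {R : ℕ} {B : Finset ℤ} {μ : Measure ℝ}
    (h : IsInvariantMeasure R B μ) {f : ℝ → ℝ≥0∞} (hf : Measurable f) :
    ∫⁻ x, f x ∂μ = (B.card : ℝ≥0∞)⁻¹ * ∑ b ∈ B, ∫⁻ x, f (tau R b x) ∂μ := by
  conv_lhs => rw [h.eq_smul_sum_map]
  rw [lintegral_smul_measure, lintegral_finsetSum_measure, smul_eq_mul]
  congr 1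
  exact Finset.sum_congr rfl fun b _ => lintegral_map hf (measurable_tau R b)

/-- τ_{b+b'}(x + y) = τ_b(x) + τ_{b'}(y), and disjoint differences make the sum over B + B' a double
sum over B and B'. -/
theorem isInvariantMeasure_conv {R : ℕ} {B B' : Finset ℤ} (hB : B.Nonempty) (hB' : B'.Nonempty)
    (hd : DisjointDifferences (B : Set ℤ) (B' : Set ℤ)) {μ ν : Measure ℝ}
    (hμ : IsInvariantMeasure R B μ) (hν : IsInvariantMeasure R B' ν) :
    IsInvariantMeasure R (B + B') (μ.conv ν) := by
  have := hμ.1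
  have := hν.1
  refine ⟨inferInstance, fun E hE => ?_⟩
  rw [disjointDifferences_iff (by simpa using hB) (by simpa using hB')] at hd
  have hinj : Set.InjOn (fun p : ℤ × ℤ => p.1 + p.2) (B ×ˢ B' : Finset (ℤ × ℤ)) := by
    rintro ⟨a, a'⟩ ha ⟨b, b'⟩ hb e
    simp only [Finset.coe_product, Set.mem_prod] at ha hb e
    have h1 := hd a ha.1 b hb.1 a' ha.2 b' hb.2 e
    exact Prod.ext h1 (by simp only; linarith)
  have himg : B + B' = (B ×ˢ B').image fun p : ℤ × ℤ => p.1 + p.2 := rfl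
  have hind : Measurable (E.indicator (fun _ => (1 : ℝ≥0∞))) := measurable_const.indicator hE
  have hval : ∀ b b', (μ.conv ν) (tau R (b + b') ⁻¹' E) =
      ∫⁻ x, ∫⁻ y, E.indicator (fun _ => 1) (tau R b x + tau R b' y) ∂ν ∂μ := by
    intro b b'
    have hm := measurable_tau R (b + b') hE
    rw [← lintegral_indicator_one hm,
      Measure.lintegral_conv (measurable_one.indicator hm)]
    refine lintegral_congr fun x => lintegral_congr fun y => ?_
    have : tau R (b + b') (x + y) = tau R b x + tau R b' y := by
      simp only [tau]
      push_cast
      ring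
    rw [← this]
    rfl
  have hstart : (μ.conv ν) E = ∫⁻ x, ∫⁻ y, E.indicator (fun _ => 1) (x + y) ∂ν ∂μ := by
    rw [← lintegral_indicator_one hE, Measure.lintegral_conv (measurable_one.indicator hE)]
    rfl
  have hmeas : Measurable fun q : ℝ × ℝ => E.indicator (fun _ => (1 : ℝ≥0∞)) (q.1 + q.2) :=
    hind.comp (measurable_fst.add measurable_snd)
  have hmeas' : ∀ b b', Measurable fun q : ℝ × ℝ =>
      E.indicator (fun _ => (1 : ℝ≥0∞)) (tau R b q.1 + tau R b' q.2) := fun b b' =>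
    hind.comp (((measurable_tau R b).comp measurable_fst).add
      ((measurable_tau R b').comp measurable_snd))
  have hmeas'' : ∀ b, Measurable fun q : ℝ × ℝ =>
      E.indicator (fun _ => (1 : ℝ≥0∞)) (tau R b q.1 + q.2) := fun b =>
    hind.comp (((measurable_tau R b).comp measurable_fst).add measurable_snd)
  rw [hstart, hμ.lintegral_eq hmeas.lintegral_prod_right', himg, Finset.sum_image hinj,
    Finset.card_image_of_injOn hinj, Finset.card_product, Finset.sum_product]
  simp only [hval]
  have hinner : ∀ b, ∫⁻ x, ∫⁻ y, E.indicator (fun _ => 1) (tau R b x + y) ∂ν ∂μ =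
      (B'.card : ℝ≥0∞)⁻¹ * ∑ b' ∈ B',
        ∫⁻ x, ∫⁻ y, E.indicator (fun _ => 1) (tau R b x + tau R b' y) ∂ν ∂μ := by
    intro b
    rw [← lintegral_finsetSum _ fun b' _ => (hmeas' b b').lintegral_prod_right',
      ← lintegral_const_mul _ (Finset.measurable_fun_sum _ fun b' _ =>
        (hmeas' b b').lintegral_prod_right')]
    refine lintegral_congr fun x => ?_
    exact hν.lintegral_eq ((hmeas'' b).comp (measurable_const.prodMk measurable_id))
  simp only [hinner]
  rw [← Finset.mul_sum, ← mul_assoc, Nat.cast_mul,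
    ENNReal.mul_inv (Or.inr (ENNReal.natCast_ne_top _)) (Or.inl (ENNReal.natCast_ne_top _))]

theorem invariantMeasure_add {R : ℕ} (hR : 2 ≤ R) {B B' : Finset ℤ} (hB : B.Nonempty)
    (hB' : B'.Nonempty) (hd : DisjointDifferences (B : Set ℤ) (B' : Set ℤ)) :
    invariantMeasure R (B + B') = (invariantMeasure R B).conv (invariantMeasure R B') :=
  (existsUnique_isInvariantMeasure hR (hB.add hB')).unique
    (isInvariantMeasure_invariantMeasure hR (hB.add hB'))
    (isInvariantMeasure_conv hB hB' hd (isInvariantMeasure_invariantMeasure hR hB)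
      (isInvariantMeasure_invariantMeasure hR hB'))

/-! ### The attractor of a complete set of residues -/

theorem zero_mem_attractor {R : ℕ} {A : Finset ℤ} (h0 : (0 : ℤ) ∈ A) : (0 : ℝ) ∈ attractor R A :=
  ⟨fun _ => ⟨0, h0⟩, by simp [codedPoint]⟩

theorem tau_mem_attractor {R : ℕ} (hR : 2 ≤ R) {A : Finset ℤ} {a : ℤ} (ha : a ∈ A) {x : ℝ}
    (hx : x ∈ attractor R A) : tau R a x ∈ attractor R A := by
  rw [(isCompact_attractor hR ⟨a, ha⟩).2.2]
  exact Set.mem_biUnion ha ⟨x, hx, rfl⟩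

/-- The integer translates of the attractor of a complete set of residues cover the line. -/
theorem exists_add_intCast_mem_attractor {R : ℕ} (hR : 2 ≤ R) {A : Finset ℤ} (h0 : (0 : ℤ) ∈ A)
    (hA : IsCompleteResidueSet R (A : Set ℤ)) (x : ℝ) : ∃ n : ℤ, x + n ∈ attractor R A := by
  have hR0 : (R : ℝ) ≠ 0 := by positivity
  have hR1 : (1 : ℝ) < R := by exact_mod_cast hR
  set Y : Set ℝ := attractor R A + Set.range (Int.cast : ℤ → ℝ) with hY
  have hmemY : ∀ y, y ∈ Y ↔ ∃ n : ℤ, y + n ∈ attractor R A := by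
    intro y
    constructor
    · rintro ⟨z, hz, _, ⟨n, rfl⟩, rfl⟩
      exact ⟨-n, by simpa using hz⟩
    · rintro ⟨n, hn⟩
      exact ⟨_, hn, _, ⟨-n, rfl⟩, by simp⟩
  have hclosed : IsClosed Y :=
    Int.isClosedEmbedding_coe_real.isClosed_range.add_left_of_isCompact
      (isCompact_attractor hR ⟨0, h0⟩).2.1
  -- With y + n in the attractor and a ≡ −n modulo R, applying τ_a gives y/R plus an integer.
  -- Starting from ℤ ⊆ Y, this puts every R^{-k}ℤ in the closed set Y.
  have hscale : ∀ y ∈ Y, (R : ℝ)⁻¹ * y ∈ Y := by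
    intro y hy
    obtain ⟨n, hn⟩ := (hmemY y).1 hy
    obtain ⟨a, ⟨ha, han⟩, -⟩ := hA (-n)
    obtain ⟨q, hq⟩ := han.dvd
    refine (hmemY _).2 ⟨-q, ?_⟩
    have := tau_mem_attractor hR ha hn
    convert this using 1
    have hq' : (n : ℝ) = -(R * q) - a := by
      have : n = -(R * q) - a := by linarith
      exact_mod_cast this
    rw [tau, hq']
    field_simp
    push_cast
    ring
  have hint : ∀ n : ℤ, (n : ℝ) ∈ Y := fun n =>
    (hmemY _).2 ⟨-n, by simpa using zero_mem_attractor h0⟩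
  have hgrid : ∀ (k : ℕ) (n : ℤ), (R : ℝ)⁻¹ ^ k * n ∈ Y := by
    intro k n
    induction k with
    | zero => simpa using hint n
    | succ k ih =>
      rw [pow_succ', mul_assoc]
      exact hscale _ ih
  have hRk : Filter.Tendsto (fun k : ℕ => (R : ℝ)⁻¹ ^ k) Filter.atTop (nhds 0) :=
    tendsto_pow_atTop_nhds_zero_of_lt_one (by positivity) (inv_lt_one_of_one_lt₀ hR1)
  have hlim : Filter.Tendsto (fun k : ℕ => (R : ℝ)⁻¹ ^ k * ⌊(R : ℝ) ^ k * x⌋) Filter.atTop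
      (nhds x) := by
    have hlow : Filter.Tendsto (fun k : ℕ => x - (R : ℝ)⁻¹ ^ k) Filter.atTop (nhds x) := by
      simpa using hRk.const_sub x
    have hx : ∀ k : ℕ, (R : ℝ)⁻¹ ^ k * ((R : ℝ) ^ k * x) = x := fun k => by
      rw [← mul_assoc, ← mul_pow, inv_mul_cancel₀ hR0, one_pow, one_mul]
    refine tendsto_of_tendsto_of_tendsto_of_le_of_le hlow tendsto_const_nhds (fun k => ?_)
      fun k => ?_
    · have h1 : (R : ℝ)⁻¹ ^ k * ((R : ℝ) ^ k * x - 1) ≤ (R : ℝ)⁻¹ ^ k * ⌊(R : ℝ) ^ k * x⌋ := by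
        gcongr
        exact (Int.sub_one_lt_floor _).le
      rw [mul_sub, hx, mul_one] at h1
      exact h1
    · have h1 : (R : ℝ)⁻¹ ^ k * ⌊(R : ℝ) ^ k * x⌋ ≤ (R : ℝ)⁻¹ ^ k * ((R : ℝ) ^ k * x) := by
        gcongr
        exact Int.floor_le _
      rw [hx] at h1
      exact h1
  exact (hmemY x).1 (hclosed.mem_of_tendsto hlim (Filter.Eventually.of_forall fun k => hgrid k _))

theorem volume_tau_image (R : ℕ) (a : ℤ) (S : Set ℝ) :
    volume (tau R a '' S) = ENNReal.ofReal (R : ℝ)⁻¹ * volume S := by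
  have : tau R a '' S = (R : ℝ)⁻¹ • ((a : ℝ) +ᵥ S) := by
    rw [← Set.image_smul, ← Set.image_vadd, Set.image_image]
    refine Set.image_congr fun x _ => ?_
    simp [tau, add_comm]
  rw [this, Measure.addHaar_smul, measure_vadd]
  simp

/-- Self-similarity with subadditivity gives one inequality between measures. Since there are
exactly R pieces scaled by 1/R, the total masses agree, and finite measures so ordered must be
equal; no prior knowledge of overlaps is needed. -/
theorem volume_restrict_attractor_eq {R : ℕ} (hR : 2 ≤ R) {A : Finset ℤ}
    (hc : A.card = R) {E : Set ℝ} (hE : MeasurableSet E) :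
    volume.restrict (attractor R A) E =
      (A.card : ℝ≥0∞)⁻¹ * ∑ a ∈ A, volume.restrict (attractor R A) (tau R a ⁻¹' E) := by
  have hne : A.Nonempty := Finset.card_pos.1 (by omega)
  obtain ⟨-, hcomp, hX⟩ := isCompact_attractor hR hne
  have hR0 : (R : ℝ≥0∞) ≠ 0 := by
    have : R ≠ 0 := by omega
    exact_mod_cast this
  have hofReal : ENNReal.ofReal (R : ℝ)⁻¹ = (A.card : ℝ≥0∞)⁻¹ := by
    rw [hc, ENNReal.ofReal_inv_of_pos (by positivity), ENNReal.ofReal_natCast]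
  set X := attractor R A with hXdef
  have : IsFiniteMeasure (volume.restrict X) := ⟨by
    rw [Measure.restrict_apply_univ]
    exact hcomp.measure_lt_top⟩
  set ρ : Measure ℝ := (A.card : ℝ≥0∞)⁻¹ • ∑ a ∈ A, (volume.restrict X).map (tau R a) with hρ
  have hρE : ∀ E, MeasurableSet E → ρ E =
      (A.card : ℝ≥0∞)⁻¹ * ∑ a ∈ A, volume.restrict X (tau R a ⁻¹' E) := by
    intro E hE
    rw [hρ, Measure.smul_apply, Measure.finsetSum_apply, smul_eq_mul]
    congr 1
    exact Finset.sum_congr rfl fun a _ => by rw [Measure.map_apply (measurable_tau R a) hE]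
  have hle : volume.restrict X ≤ ρ := by
    refine Measure.le_iff.2 fun E hE => ?_
    rw [hρE E hE, Measure.restrict_apply hE]
    have hsub : E ∩ X ⊆ ⋃ a ∈ A, tau R a '' (tau R a ⁻¹' E ∩ X) := by
      rintro x ⟨hxE, hxX⟩
      rw [hX] at hxX
      obtain ⟨a, ha, y, hy, rfl⟩ := Set.mem_iUnion₂.1 hxX
      exact Set.mem_biUnion ha ⟨y, ⟨hxE, hy⟩, rfl⟩
    refine (measure_mono hsub).trans ((measure_biUnion_finset_le A _).trans_eq ?_)
    rw [Finset.mul_sum]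
    refine Finset.sum_congr rfl fun a _ => ?_
    rw [volume_tau_image, hofReal, Measure.restrict_apply (measurable_tau R a hE)]
  have huniv : volume.restrict X Set.univ = ρ Set.univ := by
    rw [hρE _ MeasurableSet.univ]
    simp only [Set.preimage_univ, Finset.sum_const, nsmul_eq_mul]
    rw [← mul_assoc, ENNReal.inv_mul_cancel (by rwa [hc]) (ENNReal.natCast_ne_top _), one_mul]
  have : IsFiniteMeasure ρ := ⟨by rw [← huniv]; exact measure_lt_top _ _⟩
  rw [← hρE E hE, Measure.eq_of_le_of_measure_univ_eq hle huniv]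

theorem volume_attractor_ne_zero {R : ℕ} (hR : 2 ≤ R) {A : Finset ℤ} (h0 : (0 : ℤ) ∈ A)
    (hA : IsCompleteResidueSet R (A : Set ℤ)) : volume (attractor R A) ≠ 0 := by
  intro hz
  have : (Set.univ : Set ℝ) ⊆ ⋃ n : ℤ, (fun x : ℝ => x + n) ⁻¹' attractor R A := fun x _ =>
    Set.mem_iUnion.2 (exists_add_intCast_mem_attractor hR h0 hA x)
  have h1 : volume (⋃ n : ℤ, (fun x : ℝ => x + n) ⁻¹' attractor R A) = 0 :=
    measure_iUnion_null fun n => by rw [measure_preimage_add_right, hz]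
  have h2 := measure_mono_null this h1
  simp at h2

theorem invariantMeasure_eq_smul_restrict {R : ℕ} (hR : 2 ≤ R) {A : Finset ℤ} (h0 : (0 : ℤ) ∈ A)
    (hA : IsCompleteResidueSet R (A : Set ℤ)) :
    invariantMeasure R A = (volume (attractor R A))⁻¹ • volume.restrict (attractor R A) := by
  have : NeZero R := ⟨by omega⟩
  have hne : A.Nonempty := ⟨0, h0⟩
  have hv0 := volume_attractor_ne_zero hR h0 hA
  have hvt : volume (attractor R A) ≠ ⊤ := (isCompact_attractor hR hne).2.1.measure_lt_top.ne
  refine (existsUnique_isInvariantMeasure hR hne).unique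
    (isInvariantMeasure_invariantMeasure hR hne) ⟨⟨?_⟩, fun E hE => ?_⟩
  · rw [Measure.smul_apply, Measure.restrict_apply_univ, smul_eq_mul, ENNReal.inv_mul_cancel hv0 hvt]
  · rw [Measure.smul_apply, volume_restrict_attractor_eq hR hA.card_eq hE]
    simp only [Measure.smul_apply, smul_eq_mul]
    rw [← Finset.mul_sum, mul_left_comm]

/-! ### Overlaps and the spectrum `ℤ` -/

theorem expFn_add_intCast (m n : ℤ) (x : ℝ) : expFn m (x + n) = expFn m x := by
  unfold expFn
  rw [Complex.exp_eq_exp_iff_exists_int]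
  exact ⟨m * n, by push_cast; ring⟩

/-- If `ℤ` is a spectrum of a multiple of Lebesgue measure on `X`, then a subset of `X` that has a
disjoint integer translate inside `X` is null. -/
theorem volume_eq_zero_of_isSpectrum_int {X : Set ℝ} {c : ℝ≥0∞} (hc : c ≠ 0)
    {μ : Measure ℝ} [IsFiniteMeasure μ] (hμ : μ = c • volume.restrict X)
    (hs : IsSpectrum μ (Set.range fun n : ℤ => (n : ℝ))) {n : ℤ} {V : Set ℝ}
    (hV : MeasurableSet V) (hVX : V ⊆ X) (hVX' : (fun x : ℝ => x + n) ⁻¹' V ⊆ X)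
    (hdisj : Disjoint V ((fun x : ℝ => x + n) ⁻¹' V)) : volume V = 0 := by
  set W : Set ℝ := (fun x : ℝ => x + n) ⁻¹' V with hW
  have hWm : MeasurableSet W := (measurable_add_const _) hV
  have hrestr : ∀ S, MeasurableSet S → S ⊆ X → μ.restrict S = c • volume.restrict S := by
    intro S hS hSX
    rw [hμ, Measure.restrict_smul, Measure.restrict_restrict hS, Set.inter_eq_left.2 hSX]
  -- The indicators of V and of its translate V − n have equal inner products with all integer
  -- exponentials, by periodicity. Completeness makes them equal in L², which is impossible for
  -- disjoint sets unless V is null.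
  let u : Lp ℂ 2 μ := indicatorConstLp 2 hV (measure_ne_top μ V) (1 : ℂ)
  let w : Lp ℂ 2 μ := indicatorConstLp 2 hWm (measure_ne_top μ W) (1 : ℂ)
  have hexp : ∀ m : ℤ, inner ℂ (u - w) (expLp μ m) = 0 := by
    intro m
    have hint : ∀ S, MeasurableSet S → ∫ x in S, expLp μ m x ∂μ = ∫ x in S, expFn m x ∂μ :=
      fun S hS => setIntegral_congr_ae hS ((coeFn_expLp μ m).mono fun x hx _ => hx)
    rw [inner_sub_left, L2.inner_indicatorConstLp_one, L2.inner_indicatorConstLp_one, hint V hV,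
      hint W hWm, hrestr V hV hVX, hrestr W hWm hVX', integral_smul_measure, integral_smul_measure,
      ← (measurePreserving_add_right volume (n : ℝ)).setIntegral_preimage_emb
        (measurableEmbedding_addRight (n : ℝ)) (expFn m) V]
    simp only [expFn_add_intCast]
    exact sub_self _
  have htop : (⊤ : Submodule ℂ (Lp ℂ 2 μ)) ≤ (ℂ ∙ (u - w))ᗮ := by
    rw [← hs.2]
    refine Submodule.topologicalClosure_minimal _ (Submodule.span_le.2 ?_)
      (Submodule.isClosed_orthogonal _)
    rintro _ ⟨_, ⟨m, rfl⟩, rfl⟩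
    exact Submodule.mem_orthogonal_singleton_iff_inner_right.2 (hexp m)
  have huw : inner ℂ (u - w) u = 0 :=
    Submodule.mem_orthogonal_singleton_iff_inner_right.1 (htop trivial)
  rw [inner_sub_left, L2.inner_indicatorConstLp_one_indicatorConstLp_one,
    L2.inner_indicatorConstLp_one_indicatorConstLp_one, Set.inter_self,
    Set.inter_comm, hdisj.inter_eq] at huw
  have hreal : μ.real V = 0 := by simpa using huw
  have hμV : μ V = 0 := (measureReal_eq_zero_iff).1 hreal
  rw [hμ, Measure.smul_apply, Measure.restrict_apply hV, Set.inter_eq_left.2 hVX, smul_eq_mul,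
    mul_eq_zero] at hμV
  exact hμV.resolve_left hc

theorem volume_inter_preimage_add_eq_zero {X : Set ℝ} (hX : MeasurableSet X) {c : ℝ≥0∞}
    (hc : c ≠ 0) {μ : Measure ℝ} [IsFiniteMeasure μ] (hμ : μ = c • volume.restrict X)
    (hs : IsSpectrum μ (Set.range fun n : ℤ => (n : ℝ))) {n : ℤ} (hn : n ≠ 0) :
    volume (X ∩ (fun x : ℝ => x + n) ⁻¹' X) = 0 := by
  -- Cutting into half-open unit intervals makes each piece disjoint from its translate by a nonzero
  -- integer.
  set V : ℤ → Set ℝ := fun j => X ∩ (fun x : ℝ => x + n) ⁻¹' X ∩ Set.Ico (j : ℝ) (j + 1) with hV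
  have hcover : X ∩ (fun x : ℝ => x + n) ⁻¹' X = ⋃ j, V j := by
    rw [← Set.inter_iUnion, iUnion_Ico_intCast, Set.inter_univ]
  rw [hcover]
  refine measure_iUnion_null fun j => ?_
  have hm : MeasurableSet (V j) :=
    (hX.inter ((measurable_add_const _) hX)).inter measurableSet_Ico
  refine volume_eq_zero_of_isSpectrum_int (n := -n) hc hμ hs hm (fun x hx => hx.1.1)
    (fun x hx => ?_) (Set.disjoint_left.2 fun x hx hx' => ?_)
  · have := hx.1.2
    simpa using this
  · have h1 := hx.2
    have h2 := hx'.2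
    simp only [Set.mem_Ico, Int.cast_neg] at h1 h2
    have h3 : (n : ℝ) < 1 := by linarith
    have h4 : (-1 : ℝ) < n := by linarith
    have h3' : n < 1 := by exact_mod_cast h3
    have h4' : -1 < n := by exact_mod_cast h4
    omega

/-- Cutting X along the intervals [n, n+1) and moving the pieces back to [0, 1) covers it, by the
covering hypothesis, with only null overlaps. Translation invariance then gives measure 1. -/
theorem translationCongruent_of_overlap {X : Set ℝ} (hX : MeasurableSet X)
    (hcover : ∀ x : ℝ, ∃ n : ℤ, x + n ∈ X)
    (hover : ∀ n : ℤ, n ≠ 0 → volume (X ∩ (fun x : ℝ => x + n) ⁻¹' X) = 0) :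
    TranslationCongruent X (Set.Icc 0 1) ∧ volume X = 1 := by
  set A : ℤ → Set ℝ := fun n => Set.Ico 0 1 ∩ (fun x : ℝ => x + n) ⁻¹' X with hA
  have hAm : ∀ n, MeasurableSet (A n) := fun n =>
    measurableSet_Ico.inter ((measurable_add_const _) hX)
  have hAd : Pairwise fun m n => AEDisjoint volume (A m) (A n) := by
    intro m n hmn
    have hsub : A m ∩ A n ⊆
        (fun x : ℝ => x + m) ⁻¹' (X ∩ (fun x : ℝ => x + (n - m : ℤ)) ⁻¹' X) := by
      rintro x ⟨hx, hx'⟩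
      refine ⟨hx.2, ?_⟩
      have := hx'.2
      simp only [Set.mem_preimage] at this ⊢
      convert this using 1
      push_cast
      ring
    refine measure_mono_null hsub ?_
    rw [measure_preimage_add_right]
    exact hover _ (sub_ne_zero.2 hmn.symm)
  have hAU : ⋃ n, A n = Set.Ico 0 1 := by
    rw [← Set.inter_iUnion, Set.inter_eq_left]
    exact fun x _ => Set.mem_iUnion.2 (hcover x)
  have hshift : ∀ n : ℤ, (n : ℝ) +ᵥ A n = X ∩ Set.Ico (n : ℝ) (n + 1) := by
    intro n
    ext x
    rw [Set.mem_vadd_set_iff_neg_vadd_mem]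
    simp only [hA, vadd_eq_add, Set.mem_inter_iff, Set.mem_Ico, Set.mem_preimage]
    rw [show -(n : ℝ) + x + n = x by ring, and_comm]
    refine and_congr_right fun _ => and_congr ?_ ?_ <;> constructor <;> intro h <;> linarith
  have hsm : ∀ n : ℤ, MeasurableSet ((n : ℝ) +ᵥ A n) := fun n => by
    rw [hshift]
    exact hX.inter measurableSet_Ico
  have hsd : Pairwise fun m n : ℤ => AEDisjoint volume ((m : ℝ) +ᵥ A m) ((n : ℝ) +ᵥ A n) := by
    intro m n hmn
    rw [hshift, hshift]
    refine Disjoint.aedisjoint ?_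
    exact (Set.pairwise_disjoint_Ico_intCast ℝ hmn).mono Set.inter_subset_right Set.inter_subset_right
  have hsU : ⋃ n : ℤ, (n : ℝ) +ᵥ A n = X := by
    simp only [hshift]
    rw [← Set.inter_iUnion, iUnion_Ico_intCast, Set.inter_univ]
  refine ⟨⟨A, ⟨hAm, hAd, ?_⟩, ⟨hsm, hsd, ?_⟩⟩, ?_⟩
  · rw [hAU]
    exact Ico_ae_eq_Icc
  · exact hsU ▸ Filter.EventuallyEq.rfl
  · rw [← hsU, measure_iUnion₀ hsd fun n => (hsm n).nullMeasurableSet]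
    simp only [measure_vadd]
    rw [← measure_iUnion₀ hAd fun n => (hAm n).nullMeasurableSet, hAU]
    simp

end HadamardTiling

end

theorem theorem1p9 (R : ℕ) (hR : 2 ≤ R) (B L B' L' : Finset ℤ)
    (h : HadamardTiling.AreComplementary R B L B' L') :
    -- (i) `μ_{B ⊕ B'}` is Lebesgue measure on the attractor, has spectrum `ℤ`, and the attractor
    -- is translation congruent to `[0,1]`
    (HadamardTiling.invariantMeasure R (B + B') =
        volume.restrict (HadamardTiling.attractor R (B + B')) ∧
      HadamardTiling.IsSpectrum (HadamardTiling.invariantMeasure R (B + B'))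
        (Set.range (fun n : ℤ => (n : ℝ))) ∧
      HadamardTiling.TranslationCongruent (HadamardTiling.attractor R (B + B')) (Set.Icc 0 1)) ∧
    -- (ii) convolution
    HadamardTiling.invariantMeasure R (B + B') =
      (HadamardTiling.invariantMeasure R B).conv (HadamardTiling.invariantMeasure R B') ∧
    -- (iii) spectra
    (HadamardTiling.IsSpectrum (HadamardTiling.invariantMeasure R B)
        ((fun n : ℤ => (n : ℝ)) '' HadamardTiling.representable R L) ∧
      HadamardTiling.IsSpectrum (HadamardTiling.invariantMeasure R B')
        ((fun n : ℤ => (n : ℝ)) '' HadamardTiling.representable R L')) ∧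
    -- (iv) disjoint differences
    HadamardTiling.DisjointDifferences (HadamardTiling.representable R L)
      (HadamardTiling.representable R L') ∧
    -- (v) characterization of `Λ(L) ⊕ Λ(L') = ℤ`, and its meaning as a tiling
    ((HadamardTiling.IsDirectSum (HadamardTiling.representable R L)
        (HadamardTiling.representable R L') Set.univ ↔
      ∀ (r : ℕ) [NeZero r] (a : Fin r → ℤ),
        HadamardTiling.IsExtremeCycleDigits R (B + B') (L + L') a →
          HadamardTiling.IsExtremeCycleDigits R B L
              (fun k => HadamardTiling.projLeft L L' (a k)) ∧
            HadamardTiling.IsExtremeCycleDigits R B' L'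
              (fun k => HadamardTiling.projRight L L' (a k))) ∧
      (HadamardTiling.IsDirectSum (HadamardTiling.representable R L)
          (HadamardTiling.representable R L') Set.univ ↔
        HadamardTiling.TilesIntegersBy (HadamardTiling.representable R L)
          (HadamardTiling.representable R L'))) := by
  have : NeZero R := ⟨by omega⟩
  have hA0 : (0 : ℤ) ∈ B + B' := by
    simpa using Finset.add_mem_add h.pair.zero_mem_left h.pair'.zero_mem_left
  have hM0 : (0 : ℤ) ∈ L + L' := by
    simpa using Finset.add_mem_add h.pair.zero_mem_right h.pair'.zero_mem_right
  have hA : HadamardTiling.IsCompleteResidueSet R ((B + B' : Finset ℤ) : Set ℤ) := by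
    rw [Finset.coe_add]
    exact h.complete_B
  have hM : HadamardTiling.IsCompleteResidueSet R ((L + L' : Finset ℤ) : Set ℤ) := by
    rw [Finset.coe_add]
    exact h.complete_L
  have hint : ∀ (r : ℕ) [NeZero r] (x : Fin r → ℝ) (l : Fin r → ℤ),
      HadamardTiling.IsExtremeCycle R (B + B') (L + L') x l → ∀ k, ∃ n : ℤ, x k = n :=
    fun r _ x l hx k =>
      HadamardTiling.exists_eq_intCast_of_norm_maskFn_eq_one hA0 h.gcd_eq_one (hx.2 k)
  have hspec : HadamardTiling.IsSpectrum (HadamardTiling.invariantMeasure R (B + B'))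
      (Set.range (fun n : ℤ => (n : ℝ))) := by
    have := (HadamardTiling.isHadamardPair_of_isCompleteResidueSet hA hM hA0 hM0).isSpectrum hR hint
    rwa [HadamardTiling.representable_eq_univ hM, Set.image_univ] at this
  have hcomp := (HadamardTiling.isCompact_attractor hR ⟨0, hA0⟩).2.1
  have hres := HadamardTiling.invariantMeasure_eq_smul_restrict hR hA0 hA
  have htc := HadamardTiling.translationCongruent_of_overlap hcomp.measurableSet
    (HadamardTiling.exists_add_intCast_mem_attractor hR hA0 hA) fun n hn =>
      HadamardTiling.volume_inter_preimage_add_eq_zero hcomp.measurableSet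
        (ENNReal.inv_ne_zero.2 hcomp.measure_lt_top.ne) hres hspec hn
  -- The attractor has measure 1, so the normalizing factor disappears.
  rw [htc.2, inv_one, one_smul] at hres
  have hdisj := HadamardTiling.disjointDifferences_representable hR h.pair.zero_mem_right
    h.pair'.zero_mem_right h.disjointDifferences_L h.complete_L.incongruent
  refine ⟨⟨hres, hspec, htc.1⟩,
    HadamardTiling.invariantMeasure_add hR h.pair.nonempty h.pair'.nonempty
      h.disjointDifferences_B,
    ⟨h.pair.isSpectrum hR h.integer_cycles, h.pair'.isSpectrum hR h.integer_cycles'⟩, hdisj, ?_,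
    HadamardTiling.isDirectSum_univ_iff_tiles hdisj
      ⟨0, HadamardTiling.zero_mem_representable h.pair.zero_mem_right⟩
      ⟨0, HadamardTiling.zero_mem_representable h.pair'.zero_mem_right⟩⟩
  exact (and_iff_right hdisj).trans (HadamardTiling.representable_add_eq_univ_iff hR
    h.pair.nonempty h.pair'.nonempty ⟨0, hA0⟩ h.disjointDifferences_L h.complete_L
    h.integer_cycles h.integer_cycles' hint)
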